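/- **Setting.** Let $R,S$ be unital rings and $T$ a commutative ring mapping to the centres of both. A *bimodule* is an $(R,S)$-bimodule $M$ with $(rx)s=r(xs)$ and $tx=xt$ ($t\in T$). For a set $\mathcal K$ of bimodules, an infinite cardinal $\theta$ and bimodules $M_1\subseteq M_2$, write $M_1\leq_\theta M_2$ if player II has a winning strategy in the following game of length $\omega$: in move $n$ player I chooses $A_n\subseteq M_2$ with $|A_n|<\theta$, then player II chooses a sub-bimodule $K_n\subseteq M_2$; II wins iff for all $n$ we have $A_n\subseteq M_1+\sum_{\ell\le n}K_\ell$, each $K_n$ is a direct sum of fewer than $\theta$ bimodules isomorphic to members of $\mathcal K$, and $M_1+\sum_\ell K_\ell=M_1\oplus\bigoplus_\ell K_\ell$. A *context* $\mathfrak m=(\mathcal K,M_*,\mathfrak E)$ consists of a set $\mathcal K$ of bimodules, a bimodule $M_*$, and a set $\mathfrak E$ of sequences $\mathfrak e=\langle N_n^{\mathfrak e},x_n^{\mathfrak e},g_n^{\mathfrak e}:n<\omega\rangle$, where $N^{\mathfrak e}_n\in\mathcal K$, $x^{\mathfrak e}_n\in N^{\mathfrak e}_n$, and $g^{\mathfrak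 e}_n:N^{\mathfrak e}_n\to N^{\mathfrak e}_{n+1}$ is a bimodule homomorphism with $g_n^{\mathfrak e}(x_n^{\mathfrak e})=x_{n+1}^{\mathfrak e}$; $\mathfrak E$ is closed under restriction to infinite subsets of $\omega$. Let $\kappa(\mathfrak e)$ be the least infinite cardinal such that every $N^{\mathfrak e}_n$ is generated by fewer than $\kappa(\mathfrak e)$ elements, and $\kappa(\mathfrak E)=\sup_{\mathfrak e\in\mathfrak E}\kappa(\mathfrak e)$. For a bimodule $M$, let $\varphi_n^{\mathfrak e}(M)$ be the set of $w\in M$ such that for some bimodule $M'$ with $M\leq_{\aleph_0}M'$ there is an $R$-homomorphism $N_n^{\mathfrak e}\to M'$ with $x_n^{\mathfrak e}\mapsto w$; let $\varphi^{\mathfrak e}_\omega(M)=\bigcap_n\varphi_n^{\mathfrak e}(M)$. Let $L_n^{\mathfrak e}[\mathcal K]$ be the set of $z\in\varphi_n^{\mathfrak e}(N_n^{\mathfrak e})$ such that $h_1(z)-h_2(z)\in\varphi^{\mathfrak e}_\omega(N)$ for all $N\in\mathcal K$ and all bimodule homomorphisms $h_1,h_2:N_n^{\mathfrak e}\to N$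 with $h_1(x_n^{\mathfrak e})=h_2(x_n^{\mathfrak e})$. Let $P^{\mathfrak e}=\bigoplus_n N_n^{\mathfrak e}$ with canonical embeddings $f_n$, and $h^{\mathfrak e}_n:N_n^{\mathfrak e}\to P^{\mathfrak e}$, $h_n^{\mathfrak e}(y)=f_n(y)-f_{n+1}(g_n^{\mathfrak e}(y))$. **Weakly semi-nice constructions.** Let $\lambda\ge\kappa=\mathrm{cf}(\kappa)>\kappa(\mathfrak E)$ with $|\alpha|^{\aleph_0}<\lambda$ for all $\alpha<\lambda$; let $S^*\subseteq\{\alpha<\kappa:\mathrm{cf}(\alpha)=\aleph_0\}$ be stationary with stationary complement in that set; let $\langle\gamma_\alpha:\alpha\le\kappa\rangle$ be strictly increasing and continuous such that either $\kappa=\mathrm{cf}(\lambda)$, all $\gamma_\alpha<\lambda$ $(\alpha<\kappa)$ and $\gamma_{\alpha+1}-\gamma_\alpha\le\gamma_{\beta+1}-\gamma_\beta$ for $\alpha<\beta<\kappa$, or $\kappa\ne\mathrm{cf}(\lambda)$ and $\gamma_\alpha+\lambda\le\gamma_{\alpha+1}<(\lambda^{\aleph_0})^+$ for $\alpha<\kappa$;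 let $\langle\mathfrak e_\beta:\beta<|\mathfrak E|\rangle$ enumerate $\mathfrak E$. A *weakly semi-nice construction* for $(\lambda,\mathfrak m,S^*,\kappa)$ is an increasing continuous sequence $\langle M_\alpha:\alpha\le\kappa\rangle$ of bimodules, $M_\alpha$ having (up to renaming of elements) universe $\gamma_\alpha$ and $M_0\cong M_*$, together with pairwise disjoint index sets $J_\alpha$ $(\alpha<\kappa)$, such that: (E) for $\alpha\in\kappa\setminus S^*$, $M_{\alpha+1}=M_\alpha\oplus\bigoplus_{t\in J_\alpha}N_t$, where $|J_\alpha|\le\lambda$, $\mathrm{cf}(\gamma_{\alpha+1})<\lambda\Leftrightarrow|J_\alpha|<\lambda$, each $N_t$ is isomorphic to a member of $\mathcal K$, and each member of $\mathcal K$ is isomorphic to $N_t$ for at least $|M_\alpha|$ many $t\in J_\alpha$; (F) for $\delta\in S^*$, either (E) holds at $\delta$, or there are $\gamma^{**}<\delta$ and, for $s\in J_\delta$: $\mathfrak e_s\in\{\mathfrak e_\beta:\beta<\gamma^{**}\}$; an increasing sequence $\langle\alpha_{s,n}\rangle_n$ of ordinals $>\gamma^{**}$ outside $S^*$ with supremum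 $\delta$; $t_{s,n}\in J_{\alpha_{s,n}}$ with an isomorphism $h_{s,n}:N_n^{\mathfrak e_s}\to N_{t_{s,n}}$, where for $s_1\ne s_2$ the sets $\{t_{s_i,n}:n<\omega\}$ have finite intersection, and $t_{s_1,n_1}=t_{s_2,n_2}$ implies $n_1=n_2$ and $t_{s_1,n}=t_{s_2,n}$ for $n<n_1$; bimodule homomorphisms $g_{s,n}:N_n^{\mathfrak e_s}\to M_{\gamma^{**}}$; an isomorphism $h_s$ of $P^{\mathfrak e_s}$ onto a sub-bimodule $P_s$ of $M_{\delta+1}$ with $h_s\circ h_n^{\mathfrak e_s}=h_{s,n}+g_{s,n}$ for all $n$. Moreover $M_{\delta+1}$ is generated by $M_\delta\cup\bigcup_sP_s$; each $P_s$ is freely amalgamated with the sub-bimodule generated by $M_\delta\cup\bigcup_{s'\ne s}P_{s'}$ over $\sum_n\mathrm{Rang}(h_s\circ h_n^{\mathfrak e_s})$; and for each $s$ there are $\mathfrak e\in\mathfrak E$ and $z_{s,n}\in M_\delta$ such that for no $\alpha\in[\delta,\kappa]$ and $y\in M_\alpha$ does $y-z_{s,n}\in\varphi_n^{\mathfrak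 e}(M_\alpha)$ hold for all $n$. **Semi-nice constructions.** Property $(G)_1$: for every $R$-endomorphism $f$ of $M_\kappa$, every $\mathfrak e\in\mathfrak E$, $\gamma<\kappa$ and bimodule homomorphisms $g_n:N_n^{\mathfrak e}\to M_\gamma$ $(n<\omega)$ there are $y\in M_\kappa$, $z\in P^{\mathfrak e}$ and $z_{n,i,\ell}\in N_\ell^{\mathfrak e}$ $(n,\ell<\omega,\ i<2)$, with $z_{n,i,\ell}=0$ for all large $\ell$ (given $n$), such that for all large $n$ $$z\in\sum_{\ell}h_\ell^{\mathfrak e}(z_{n,1,\ell}-z_{n,0,\ell})+\varphi_n^{\mathfrak e}(P^{\mathfrak e}),\qquad \sum_{\ell<n}f(g_\ell(x_\ell^{\mathfrak e}))\in y+\sum_\ell g_\ell(z_{n,1,\ell})+\varphi_n^{\mathfrak e}(M_\kappa).$$ Every semi-nice construction is a weakly semi-nice construction with property $(G)_1$. **Statement.** Let $\langle M_\alpha:\alpha\le\kappa\rangle$ be a weakly semi-nice construction for $(\lambda,\mathfrak m,S^*,\kappa)$, $f$ an $R$-endomorphism of $M_\kappa$ and $\mathfrak e\in\mathfrak E$.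 (1) Let $\alpha\in\kappa\setminus S^*$ and $n<\omega$. Suppose that $f(h(x_n^{\mathfrak e}))\in M_\alpha+\mathrm{Rang}(h)+\varphi_\ell^{\mathfrak e}(M_\kappa)$ for all $\ell<\omega$ whenever $\beta\in\kappa\setminus S^*$, $\beta>\alpha$, and $h:N_n^{\mathfrak e}\to M_\beta$ is a bimodule homomorphism with $M_\alpha+\mathrm{Rang}(h)=M_\alpha\oplus\mathrm{Rang}(h)\leq_{\aleph_0}M_\beta$. Then there is $z\in L_n^{\mathfrak e}[\mathcal K]$ such that $f(h(x_n^{\mathfrak e}))-h(z)\in M_\alpha+\varphi_\omega^{\mathfrak e}(M_\kappa)$ for every bimodule homomorphism $h:N_n^{\mathfrak e}\to M_\kappa$. (2) Suppose that the construction has property $(G)_1$ (for instance, that it is semi-nice). Then there are $\alpha\in\kappa\setminus S^*$ and $n<\omega$ such that $f(h(x_n^{\mathfrak e}))\in M_\alpha+\varphi_\ell^{\mathfrak e}(M_\kappa)+\mathrm{Rang}(h)$ for every bimodule homomorphism $h:N_n^{\mathfrak e}\to M_\kappa$ and every $\ell<\omega$. Moreover, there are $\alpha<\kappa$, $n(*)<\omega$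 and $z\in L_{n(*)}^{\mathfrak e}[\mathcal K]$ such that $$f(h(x_{n(*)}^{\mathfrak e}))-h(z)\in M_\alpha+\varphi_\omega^{\mathfrak e}(M_\kappa)\quad\text{for every bimodule homomorphism } h:N_{n(*)}^{\mathfrak e}\to M_\kappa .$$ -/

import Mathlib

open scoped TensorProduct Cardinal

universe u

namespace SemiNice

/-- An `(R, S)`-bimodule on which the common central subring `T` acts symmetrically (`t x = x t`)
is the same thing as a module over `R ⊗[T] Sᵐᵒᵖ`, with `(r ⊗ op s) • x = r x s`.  Bimodules,
sub-bimodules and bimodule homomorphisms are modules, submodules and linear maps over this ring. -/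
abbrev BiRing (R S T : Type u) [Ring R] [Ring S] [CommRing T] [Algebra T R] [Algebra T S] :
    Type u := R ⊗[T] Sᵐᵒᵖ

/-- Bundled `(R, S)`-bimodules. -/
abbrev Bimod (R S T : Type u) [Ring R] [Ring S] [CommRing T] [Algebra T R] [Algebra T S] :
    Type (u + 1) := ModuleCat.{u} (BiRing R S T)

section

variable {R S T : Type u} [Ring R] [Ring S] [CommRing T] [Algebra T R] [Algebra T S]

/-- An additive map between bimodules is a homomorphism of left `R`-modules. -/
def IsRLinear {V W : Type u} [AddCommGroup V] [Module (BiRing R S T) V]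
    [AddCommGroup W] [Module (BiRing R S T) W] (f : V →+ W) : Prop :=
  ∀ (r : R) (v : V),
    f ((r ⊗ₜ[T] (1 : Sᵐᵒᵖ) : BiRing R S T) • v) = (r ⊗ₜ[T] (1 : Sᵐᵒᵖ) : BiRing R S T) • f v

/-! ### Direct sums of members of a class of bimodules and almost direct summands -/

/-- `P` is a direct sum of fewer than `c` bimodules, each isomorphic to a member of `K`. -/
def IsSumOfFew (K : Set (Bimod R S T)) (c : Cardinal.{u})
    (P : Type u) [AddCommGroup P] [Module (BiRing R S T) P] : Prop :=
  ∃ (J : Type u) (X : J → Bimod R S T), #J < c ∧ (∀ i, X i ∈ K) ∧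
    Nonempty (P ≃ₗ[BiRing R S T] DirectSum J fun i => X i)

/-- `M₁` is an almost direct `K`-summand of `M₂` with respect to `c`: player II has a winning
strategy in the game of length `ω` in which, at move `n`, player I plays a subset `A n` of `M₂`
of cardinality `< c`, and player II answers with a sub-bimodule of `M₂`.  The strategy `σ` is
fed with the list `[A 0, …, A n]` of the moves made so far by player I. -/
def AlmostSummand (K : Set (Bimod R S T)) (c : Cardinal.{u})
    {W : Type u} [AddCommGroup W] [Module (BiRing R S T) W]
    (M₁ M₂ : Submodule (BiRing R S T) W) : Prop :=
  M₁ ≤ M₂ ∧ ∃ σ : List (Set W) → Submodule (BiRing R S T) W,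
    ∀ A : ℕ → Set W, (∀ n, A n ⊆ M₂ ∧ #(A n) < c) →
      ∀ Q : ℕ → Submodule (BiRing R S T) W, (∀ n, Q n = σ ((List.range (n + 1)).map A)) →
        (∀ n, Q n ≤ M₂) ∧
        (∀ n, A n ⊆ (M₁ ⊔ ⨆ l ≤ n, Q l : Submodule (BiRing R S T) W)) ∧
        (∀ n, IsSumOfFew K c (Q n)) ∧
        iSupIndep (fun o : Option ℕ => o.elim M₁ Q)

/-! ### The sequences `⟨N n, x n, g n⟩` -/

variable (R S T) in
/-- A sequence of bimodules `N n` with elements `x n` and bimodule homomorphisms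
`g n : N n → N (n + 1)` mapping `x n` to `x (n + 1)`. -/
structure ESystem where
  N : ℕ → Bimod R S T
  x : ∀ n, N n
  g : ∀ n, N n →ₗ[BiRing R S T] N (n + 1)
  g_x : ∀ n, g n (x n) = x (n + 1)

namespace ESystem

/-- The composite homomorphism `N a → N b` for `a ≤ b`. -/
def trans (e : ESystem R S T) (a : ℕ) {b : ℕ} (h : a ≤ b) :
    e.N a →ₗ[BiRing R S T] e.N b :=
  Nat.leRec (motive := fun b _ => e.N a →ₗ[BiRing R S T] e.N b)
    LinearMap.id (fun b _ f => (e.g b).comp f) h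

theorem trans_x (e : ESystem R S T) (a : ℕ) {b : ℕ} (h : a ≤ b) :
    e.trans a h (e.x a) = e.x b := by
  induction b, h using Nat.le_induction with
  | base => simp [trans]
  | succ b hb ih =>
    have h1 : e.trans a (Nat.le_succ_of_le hb) = (e.g b).comp (e.trans a hb) :=
      Nat.leRec_succ _ _ hb
    calc e.trans a (Nat.le_succ_of_le hb) (e.x a)
        = e.g b (e.trans a hb (e.x a)) := by rw [h1]; rfl
      _ = e.x (b + 1) := by rw [ih, e.g_x]

/-- The restriction of the sequence to the infinite subset of `ω` enumerated by `m`. -/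
def restrict (e : ESystem R S T) (m : ℕ → ℕ) (hm : StrictMono m) : ESystem R S T where
  N l := e.N (m l)
  x l := e.x (m l)
  g l := e.trans (m l) (hm.monotone (Nat.le_succ l))
  g_x l := e.trans_x (m l) (hm.monotone (Nat.le_succ l))

/-- The first infinite cardinal `c` such that each bimodule `N n` is generated by a set of
fewer than `c` elements. -/
noncomputable def genCard (e : ESystem R S T) : Cardinal.{u} :=
  sInf {c | ℵ₀ ≤ c ∧ ∀ n, ∃ A : Set (e.N n), #A < c ∧ Submodule.span (BiRing R S T) A = ⊤}

/-- The bimodule `P = ⨁ n, N n`. -/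
abbrev P (e : ESystem R S T) : Type u := DirectSum ℕ fun n => e.N n

/-- The embedding `y ↦ fₙ y - fₙ₊₁ (gₙ y)` of `N n` into `P`, where `fₙ : N n → P` denotes the
canonical embedding. -/
noncomputable def hP (e : ESystem R S T) (n : ℕ) : e.N n →ₗ[BiRing R S T] e.P :=
  DirectSum.lof (BiRing R S T) ℕ (fun n => e.N n) n -
    (DirectSum.lof (BiRing R S T) ℕ (fun n => e.N n) (n + 1)).comp (e.g n)

end ESystem

/-- The set `φₙ(W)`: those `w` such that, for some bimodule `W'` of which `W` is an almost direct
`K`-summand with respect to `ℵ₀`, some homomorphism of `R`-modules from `N n` to `W'` maps `x n`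
to `w`. -/
def phi (K : Set (Bimod R S T)) (e : ESystem R S T) (n : ℕ)
    (W : Type u) [AddCommGroup W] [Module (BiRing R S T) W] : Set W :=
  {w | ∃ (W' : Bimod R S T) (i : W →ₗ[BiRing R S T] W'), Function.Injective i ∧
    AlmostSummand K ℵ₀ (LinearMap.range i) ⊤ ∧
    ∃ v : e.N n →+ W', IsRLinear (R := R) (S := S) (T := T) v ∧ v (e.x n) = i w}

/-- The set `φ_ω(W)`, the intersection of all `φₙ(W)`. -/
def phiOmega (K : Set (Bimod R S T)) (e : ESystem R S T)
    (W : Type u) [AddCommGroup W] [Module (BiRing R S T) W] : Set W :=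
  ⋂ n, phi K e n W

/-- The set `Lₙ[K]`: those `z ∈ φₙ(N n)` whose image under a bimodule homomorphism into a member
of `K` is determined, modulo `φ_ω`, by the image of `x n`. -/
def L (K : Set (Bimod R S T)) (e : ESystem R S T) (n : ℕ) : Set (e.N n) :=
  {z | z ∈ phi K e n (e.N n) ∧
    ∀ W ∈ K, ∀ h₁ h₂ : e.N n →ₗ[BiRing R S T] W,
      h₁ (e.x n) = h₂ (e.x n) → h₁ z - h₂ z ∈ phiOmega K e W}

/-! ### Contexts -/

variable (R S T) in
/-- A context: a set `K` of bimodules, a bimodule `Mstar`, and a set `E` of sequences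
`⟨N n, x n, g n⟩` which is closed under restrictions to infinite subsets of `ω` and whose
bimodules are in `K`. -/
structure Context where
  K : Set (Bimod R S T)
  small_K : Small.{u} K
  Mstar : Bimod R S T
  E : Set (ESystem R S T)
  small_E : Small.{u} E
  restrict_mem : ∀ e ∈ E, ∀ (m : ℕ → ℕ) (hm : StrictMono m), e.restrict m hm ∈ E
  N_mem : ∀ e ∈ E, ∀ n, e.N n ∈ K

namespace Context

/-- The cardinality of the set `E`. -/
noncomputable def cardE (C : Context R S T) : Cardinal.{u} :=
  haveI := C.small_E
  #(Shrink.{u} C.E)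

/-- The supremum of the cardinals `genCard e` for `e ∈ E`. -/
noncomputable def genCard (C : Context R S T) : Cardinal.{u} :=
  ⨆ e : C.E, e.1.genCard

end Context

/-! ### Weakly semi-nice constructions

Throughout, `M α` (for ordinals `α ≤ κ`) are sub-bimodules of one bimodule `V = M κ`; `J α` are
sets of indices, and `N t` is, for an index `t`, a sub-bimodule of `V`. -/

/-- The step from `α` to `α + 1` adds a direct sum of copies of members of `K`. -/
structure DirectStep (C : Context R S T) (lam : Cardinal.{u}) (γ : Ordinal.{u} → Ordinal.{u})
    {V : Bimod R S T} (M : Ordinal.{u} → Submodule (BiRing R S T) V)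
    {I : Type u} (J : Ordinal.{u} → Set I) (N : I → Submodule (BiRing R S T) V)
    (α : Ordinal.{u}) : Prop where
  succ_eq : M (Order.succ α) = M α ⊔ ⨆ t ∈ J α, N t
  indep : iSupIndep (fun o : Option (J α) => o.elim (M α) (fun t => N t))
  card_le : #(J α) ≤ lam
  card_lt : (γ (Order.succ α)).cof < lam ↔ #(J α) < lam
  iso_mem : ∀ t ∈ J α, ∃ X ∈ C.K, Nonempty (N t ≃ₗ[BiRing R S T] X)
  many : ∀ X ∈ C.K, #(M α) ≤ #{t : J α // Nonempty (N t ≃ₗ[BiRing R S T] X)}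

/-- The step from `δ` to `δ + 1` glues copies `P s` (for `s ∈ J δ`) of bimodules `P` belonging to
members of `E`, and the types `{φₙ(y - z s n) : n < ω}` are omitted from then on. -/
structure GlueStep (C : Context R S T) (enumE : Ordinal.{u} → ESystem R S T)
    (kap : Cardinal.{u}) (St : Set Ordinal.{u})
    {V : Bimod R S T} (M : Ordinal.{u} → Submodule (BiRing R S T) V)
    {I : Type u} (J : Ordinal.{u} → Set I) (N : I → Submodule (BiRing R S T) V)
    (δ : Ordinal.{u}) where
  /-- the bound `γ**` -/
  bound : Ordinal.{u}
  bound_lt : bound < δ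
  e : J δ → ESystem R S T
  e_mem : ∀ s, ∃ β < bound, β < C.cardE.ord ∧ e s = enumE β
  a : J δ → ℕ → Ordinal.{u}
  a_strictMono : ∀ s, StrictMono (a s)
  bound_lt_a : ∀ s n, bound < a s n
  a_not_mem : ∀ s n, a s n ∉ St
  a_lub : ∀ s, IsLUB (Set.range (a s)) δ
  t : J δ → ℕ → I
  t_mem : ∀ s n, t s n ∈ J (a s n)
  /-- the isomorphism of `N n` onto the summand with index `t s n` -/
  iso : ∀ s n, (e s).N n ≃ₗ[BiRing R S T] N (t s n)
  tree_finite : ∀ s₁ s₂, s₁ ≠ s₂ → (Set.range (t s₁) ∩ Set.range (t s₂)).Finite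
  tree_eq : ∀ s₁ s₂, s₁ ≠ s₂ → ∀ n₁ n₂, t s₁ n₁ = t s₂ n₂ →
    n₁ = n₂ ∧ ∀ n < n₁, t s₁ n = t s₂ n
  g : ∀ s n, (e s).N n →ₗ[BiRing R S T] V
  g_range : ∀ s n, LinearMap.range (g s n) ≤ M bound
  P : J δ → Submodule (BiRing R S T) V
  h : ∀ s, (e s).P →ₗ[BiRing R S T] V
  h_injective : ∀ s, Function.Injective (h s)
  h_range : ∀ s, LinearMap.range (h s) = P s
  h_comp : ∀ s n, (h s).comp ((e s).hP n) = (N (t s n)).subtype.comp (iso s n).toLinearMap + g s n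
  succ_eq : M (Order.succ δ) = M δ ⊔ ⨆ s, P s
  /-- `P s` and the sub-bimodule generated by `M δ` and the other `P s'` are amalgamated freely
  over the sum of the images of the bimodules `N n`. -/
  amalgam : ∀ s, P s ⊓ (M δ ⊔ ⨆ s', ⨆ _ : s' ≠ s, P s') =
    ⨆ n, LinearMap.range ((h s).comp ((e s).hP n))
  qe : J δ → ESystem R S T
  qe_mem : ∀ s, qe s ∈ C.E
  z : J δ → ℕ → V
  z_mem : ∀ s n, z s n ∈ M δ
  omitted : ∀ s, ∀ α, δ ≤ α → α ≤ kap.ord →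
    ¬ ∃ y : M α, ∀ n, ∃ w ∈ phi C.K (qe s) n (M α), (w : V) = y - z s n

/-- Weakly semi-nice constructions for `(lam, C, St, γ)`, of length `kap`. -/
structure WeaklySemiNice (C : Context R S T) (lam kap : Cardinal.{u}) (St : Set Ordinal.{u})
    (γ : Ordinal.{u} → Ordinal.{u}) where
  kap_regular : kap.IsRegular
  kap_le : kap ≤ lam
  genCard_lt : C.genCard < kap
  pow_lt : ∀ α < lam.ord, α.card ^ ℵ₀ < lam
  St_sub : ∀ α ∈ St, α < kap.ord ∧ α.cof = ℵ₀
  St_stationary : IsStationary {α : Set.Iio kap.ord | α.1 ∈ St}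
  St_compl_stationary : IsStationary {α : Set.Iio kap.ord | α.1.cof = ℵ₀ ∧ α.1 ∉ St}
  γ_lt : ∀ α β, α < β → β ≤ kap.ord → γ α < γ β
  γ_continuous : ∀ δ ≤ kap.ord, Order.IsSuccLimit δ → IsLUB (γ '' Set.Iio δ) (γ δ)
  enumE : Ordinal.{u} → ESystem R S T
  enumE_bij : Set.BijOn enumE (Set.Iio C.cardE.ord) C.E
  /-- the bimodule `M κ` -/
  V : Bimod R S T
  M : Ordinal.{u} → Submodule (BiRing R S T) V
  M_kap : M kap.ord = ⊤
  /-- up to renaming of elements, the universe of `M α` is the ordinal `γ α` -/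
  code : V ≃ Set.Iio (γ kap.ord)
  mem_iff : ∀ α ≤ kap.ord, ∀ v, v ∈ M α ↔ (code v : Ordinal.{u}) < γ α
  M_mono : ∀ α β, α < β → β ≤ kap.ord → M α ≤ M β
  M_limit : ∀ δ ≤ kap.ord, Order.IsSuccLimit δ → (M δ : Set V) = ⋃ α ∈ Set.Iio δ, (M α : Set V)
  M_zero : Nonempty (M 0 ≃ₗ[BiRing R S T] C.Mstar)
  /-- the type of indices -/
  I : Type u
  J : Ordinal.{u} → Set I
  J_disjoint : ∀ α β, β < α → α < kap.ord → Disjoint (J α) (J β)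
  N : I → Submodule (BiRing R S T) V
  step : ∀ α < kap.ord, α ∉ St → DirectStep C lam γ M J N α
  step_St : ∀ δ ∈ St, DirectStep C lam γ M J N δ ∨
    Nonempty (GlueStep C enumE kap St M J N δ)

/-- The condition on the ordinals `γ α` in the notion of a construction for
`(lam, C, St, kap)`. -/
def GammaCondition (lam kap : Cardinal.{u}) (γ : Ordinal.{u} → Ordinal.{u}) : Prop :=
  (kap = lam.ord.cof ∧ (∀ α < kap.ord, γ α < lam.ord) ∧
    ∀ α β, α < β → β < kap.ord → γ (Order.succ α) - γ α ≤ γ (Order.succ β) - γ β) ∨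
  (kap ≠ lam.ord.cof ∧ ∀ α < kap.ord,
    γ α + lam.ord ≤ γ (Order.succ α) ∧ γ (Order.succ α) < (Order.succ (lam ^ ℵ₀)).ord)

/-- Bimodule homomorphisms `h : X → M₂` with `X` isomorphic to a member of `K`, such that the sum
of `M₁` and the range of `h` is direct and is an almost direct `K`-summand of `M₂`. -/
structure Hds (K : Set (Bimod R S T)) {V : Bimod R S T} (M₁ M₂ : Submodule (BiRing R S T) V)
    (X : Bimod R S T) (h : X →ₗ[BiRing R S T] V) : Prop where
  le : M₁ ≤ M₂
  range_le : LinearMap.range h ≤ M₂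
  iso_mem : ∃ Y ∈ K, Nonempty (X ≃ₗ[BiRing R S T] Y)
  disjoint : Disjoint M₁ (LinearMap.range h)
  almost : AlmostSummand K ℵ₀ (M₁ ⊔ LinearMap.range h) M₂

namespace WeaklySemiNice

variable {C : Context R S T} {lam kap : Cardinal.{u}} {St : Set Ordinal.{u}}
  {γ : Ordinal.{u} → Ordinal.{u}}

/-- The property which (for endomorphisms of the `R`-module `M κ`) distinguishes semi-nice from
weakly semi-nice constructions.  The families `z n i` of elements `z n i l ∈ N l`, almost all of
them zero, are given as elements of the direct sum `P` of the `N l`. -/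
def EndoApprox (A : WeaklySemiNice C lam kap St γ) : Prop :=
  ∀ f : A.V →+ A.V, IsRLinear (R := R) (S := S) (T := T) f →
  ∀ e ∈ C.E, ∀ c < kap.ord, ∀ g : ∀ n, e.N n →ₗ[BiRing R S T] A.V,
    (∀ n, LinearMap.range (g n) ≤ A.M c) →
    ∃ (y : A.V) (z : e.P) (zz : ℕ → Fin 2 → e.P), ∃ n₀ : ℕ, ∀ n ≥ n₀,
      (z - DirectSum.toModule (BiRing R S T) ℕ e.P e.hP (zz n 1 - zz n 0) ∈ phi C.K e n e.P) ∧
      ((∑ l ∈ Finset.range n, f (g l (e.x l))) - y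
        - DirectSum.toModule (BiRing R S T) ℕ A.V g (zz n 1) ∈ phi C.K e n A.V)

/-- For every bimodule homomorphism `h : N n → M κ` and every `l < ω`, the element `f (h (x n))`
is in `M α + φ_l(M κ) + range h`. -/
def Pr (A : WeaklySemiNice C lam kap St γ) (f : A.V →+ A.V) (e : ESystem R S T)
    (α : Ordinal.{u}) (n : ℕ) : Prop :=
  ∀ h : e.N n →ₗ[BiRing R S T] A.V, ∀ l : ℕ,
    ∃ a ∈ A.M α, ∃ b ∈ phi C.K e l A.V, ∃ c ∈ LinearMap.range h, f (h (e.x n)) = a + b + c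

/-- The same only for homomorphisms `h` into `M β` with `Hds (M α) (M β) (N n) h`, for some
`β > α` outside `St`. -/
def PrMinus (A : WeaklySemiNice C lam kap St γ) (f : A.V →+ A.V) (e : ESystem R S T)
    (α : Ordinal.{u}) (n : ℕ) : Prop :=
  ∀ β, α < β → β < kap.ord → β ∉ St → ∀ h : e.N n →ₗ[BiRing R S T] A.V,
    Hds C.K (A.M α) (A.M β) (e.N n) h → ∀ l : ℕ,
    ∃ a ∈ A.M α, ∃ b ∈ phi C.K e l A.V, ∃ c ∈ LinearMap.range h, f (h (e.x n)) = a + b + c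

/-- For every bimodule homomorphism `h : N n → M κ`, the element `f (h (x n)) - h z` is in
`M α + φ_ω(M κ)`. -/
def PrOne (A : WeaklySemiNice C lam kap St γ) (f : A.V →+ A.V) (e : ESystem R S T)
    (α : Ordinal.{u}) (n : ℕ) (z : e.N n) : Prop :=
  ∀ h : e.N n →ₗ[BiRing R S T] A.V,
    ∃ a ∈ A.M α, ∃ b ∈ phiOmega C.K e A.V, f (h (e.x n)) - h z = a + b

end WeaklySemiNice

end

end SemiNice

/-!
Almost direct summands are handled through `Good`, a positional form of the game: a set of safe
positions of player II, each of which can absorb any given element by a further finite direct sum.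
In this form almost direct summands compose (`Good.trans`), are preserved by pushouts
(`Good.push`), and pass to increasing unions (`Good.of_family`).  It follows that the sets `φₙ` are
subgroups, are preserved by bimodule homomorphisms, and may be computed in an almost direct summand
or in a direct factor of one (`mem_phi_of_add_mem`).

The structural fact about the construction is that `M α` is an almost direct summand of `M β`
whenever `α ≤ β` and `α ∉ St` (`WeaklySemiNice.good`), by induction on `β`.  The only difficult case
is a glueing step at `δ`.  There `M (δ + 1)` is the directed union of the submodules `stage β D`,
generated by `M β` with `β < δ` and, for finitely many branches `s ∈ D`, by the summand of `P s`
whose index is the first one not yet amalgamated into `M β`.  Passing from one such submodule to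
a later one amounts to exchanging summands `N t` for summands of `P s`
(`good_exchange_family`), because the glueing identifies `N t` with the graph of a homomorphism.

Suppose that `f (h x)` is controlled for the free homomorphisms `h` over `M α`.  A new copy `h₁` of
`N n` above the range of a given `h` makes both `h₁` and `h + h₁` free; subtracting the two
statements and projecting onto the copy controls `f (h x)` modulo `M α + φ_l`, with an element
`z` which can be read off from one fixed free copy.  Playing one move of the game from `M α`
replaces the `l`-dependent remainders by a single one in `φ_ω` (`PrMinus.exists_prOne`).

If, on the other hand, the control fails for all `α ∉ St` and all `n`, then choose witnesses of
failure `h k` along a sequence of stages converging to some `δ ∉ St`, which exists because `St` has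
stationary complement, and of indices growing fast enough to absorb the `φ_l` involved.  The
approximation property for the sequence `h k` yields an element `y`, which can be projected to
`M δ`, so that it lies below some stage; removing the contributions of the later `h j`
(`mem_phi_of_sub_sum_mem`) contradicts the failure at that stage (`EndoApprox.exists_prMinus`).
-/

namespace SemiNice

section

variable {R S T : Type u} [Ring R] [Ring S] [CommRing T] [Algebra T R] [Algebra T S]

/-! ### Independent families over a submodule -/

/-- The members `p i` of the family `p` with `i ∈ D` are independent over `M`, that is, their sum
with `M` is direct relative to `M`: no nontrivial finite sum of elements of the `p i` lies in
`M`. -/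
def IndepOver {ι A W : Type*} [Ring A] [AddCommGroup W] [Module A W] (M : Submodule A W)
    (p : ι → Submodule A W) (D : Set ι) : Prop :=
  ∀ s : Finset ι, ↑s ⊆ D → ∀ v : ι → W, (∀ i ∈ s, v i ∈ p i) → ∑ i ∈ s, v i ∈ M →
    ∀ i ∈ s, v i = 0

section

variable {ι A W : Type*} [Ring A] [AddCommGroup W] [Module A W] {M : Submodule A W}
  {p : ι → Submodule A W} {D : Set ι}

theorem mem_finset_sup_iff [DecidableEq ι] (s : Finset ι) (w : W) :
    w ∈ s.sup p ↔ ∃ v : ι → W, (∀ i ∈ s, v i ∈ p i) ∧ ∑ i ∈ s, v i = w := by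
  constructor
  · intro h
    induction s using Finset.induction_on generalizing w with
    | empty => exact ⟨0, by simp, by simpa using h.symm⟩
    | insert a s ha ih =>
      rw [Finset.sup_insert, Submodule.mem_sup] at h
      obtain ⟨x, hx, y, hy, rfl⟩ := h
      obtain ⟨v, hv, rfl⟩ := ih y hy
      refine ⟨Function.update v a x, ?_, ?_⟩
      · intro i hi
        rcases Finset.mem_insert.1 hi with rfl | hi
        · simpa using hx
        · have : i ≠ a := fun h => ha (h ▸ hi)
          simpa [Function.update_of_ne this] using hv i hi
      · rw [Finset.sum_insert ha, Function.update_self, Finset.sum_update_of_notMem ha]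
  · rintro ⟨v, hv, rfl⟩
    exact Submodule.sum_mem _ fun i hi => (Finset.le_sup (f := p) hi) (hv i hi)

theorem IndepOver.subset {D' : Set ι} (h : IndepOver M p D) (hD : D' ⊆ D) : IndepOver M p D' :=
  fun s hs => h s (hs.trans hD)

theorem IndepOver.comp {ι' : Type*} {f : ι' → ι} {D' : Set ι'} (h : IndepOver M p D)
    (hf : Set.InjOn f D') (hD : Set.MapsTo f D' D) : IndepOver M (fun i => p (f i)) D' := by
  classical
  intro s hs v hv hsum i hi
  have hinj : Set.InjOn f s := hf.mono hs
  have key : ∀ i ∈ s, ∀ j ∈ s, f j = f i → v j = v i := fun i hi j hj hij => by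
    rw [hinj hj hi hij]
  let w : ι → W := fun x => if hx : ∃ j ∈ s, f j = x then v hx.choose else 0
  have hw : ∀ i ∈ s, w (f i) = v i := by
    intro i hi
    have hx : ∃ j ∈ s, f j = f i := ⟨i, hi, rfl⟩
    simp only [w, dif_pos hx]
    exact key i hi _ hx.choose_spec.1 hx.choose_spec.2
  rw [← hw i hi]
  refine h (s.image f) ?_ w ?_ ?_ _ (Finset.mem_image_of_mem f hi)
  · intro x hx
    obtain ⟨j, hj, rfl⟩ := Finset.mem_image.1 hx
    exact hD (hs hj)
  · intro x hx
    obtain ⟨j, hj, rfl⟩ := Finset.mem_image.1 hx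
    rw [hw j hj]
    exact hv j hj
  · rw [Finset.sum_image hinj, Finset.sum_congr rfl hw]
    exact hsum

theorem IndepOver.of_iSupIndep (h : iSupIndep (fun o : Option ι => o.elim M p)) :
    IndepOver M p Set.univ := by
  classical
  intro s _ v hv hs i hi
  rw [iSupIndep_iff_finsetSum_eq_zero_imp_eq_zero] at h
  have := h (Finset.insertNone s) (fun o => o.elim (-∑ i ∈ s, v i) v) (by
    intro o ho
    cases o with
    | none => simpa using hs
    | some j => exact hv j (Finset.some_mem_insertNone.1 ho)) (by simp) (some i)
    (Finset.some_mem_insertNone.2 hi)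
  exact this

theorem IndepOver.of_subtype (h : IndepOver M (fun i : D => p i) Set.univ) :
    IndepOver M p D := by
  classical
  intro s hs v hv hsum i hi
  have hmap : (s.subtype (· ∈ D)).map (Function.Embedding.subtype _) = s :=
    Finset.subtype_map_of_mem fun i hi => hs hi
  refine h (s.subtype (· ∈ D)) (Set.subset_univ _) (fun i => v i)
    (fun i hi => hv i (Finset.mem_subtype.1 hi)) ?_ ⟨i, hs hi⟩ (Finset.mem_subtype.2 hi)
  rw [← hmap, Finset.sum_map] at hsum
  exact hsum

theorem IndepOver.iSupIndep (h : IndepOver M p Set.univ) :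
    iSupIndep (fun o : Option ι => o.elim M p) := by
  classical
  rw [iSupIndep_iff_finsetSum_eq_zero_imp_eq_zero]
  intro s v hv hs
  have key : ∀ i ∈ s.eraseNone, v (some i) = 0 := by
    refine h _ (Set.subset_univ _) (fun i => v (some i))
      (fun i hi => hv _ (Finset.mem_eraseNone.1 hi)) ?_
    have h1 : ∑ o ∈ s.erase none, v o = ∑ i ∈ s.eraseNone, v (some i) := by
      rw [← Finset.map_some_eraseNone, Finset.sum_map]; rfl
    rw [← h1]
    by_cases hn : none ∈ s
    · rw [← Finset.add_sum_erase _ _ hn] at hs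
      rw [← neg_eq_of_add_eq_zero_right hs]
      exact M.neg_mem (hv none hn)
    · rw [Finset.erase_eq_of_notMem hn, hs]
      exact M.zero_mem
  have key' : ∀ i, some i ∈ s → v (some i) = 0 := fun i hi => key i (Finset.mem_eraseNone.2 hi)
  intro o ho
  cases o with
  | some i => exact key' i ho
  | none =>
    rw [Finset.sum_eq_single_of_mem none ho] at hs
    · exact hs
    · intro b hb hne
      cases b with
      | none => exact absurd rfl hne
      | some i => exact key' i hb

theorem IndepOver.disjoint_finset_sup (h : IndepOver M p D) {s : Finset ι} (hs : ↑s ⊆ D) :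
    Disjoint M (s.sup p) := by
  classical
  rw [Submodule.disjoint_def]
  intro x hx hxs
  obtain ⟨v, hv, rfl⟩ := (mem_finset_sup_iff s x).1 hxs
  exact Finset.sum_eq_zero (h s hs v hv hx)

theorem IndepOver.disjoint_sup (h : IndepOver M p D) {s : Finset ι} (hs : ↑s ⊆ D) {j : ι}
    (hjD : j ∈ D) (hj : j ∉ s) : Disjoint (M ⊔ s.sup p) (p j) := by
  classical
  rw [Submodule.disjoint_def]
  intro x hx hxj
  obtain ⟨m, hm, y, hy, rfl⟩ := Submodule.mem_sup.1 hx
  obtain ⟨v, hv, rfl⟩ := (mem_finset_sup_iff s y).1 hy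
  have := h (insert j s) (by
      rw [Finset.coe_insert]
      exact Set.insert_subset hjD hs) (Function.update (fun i => - v i) j (m + ∑ i ∈ s, v i)) (by
    intro i hi
    rcases Finset.mem_insert.1 hi with rfl | hi
    · simpa using hxj
    · have : i ≠ j := fun h => hj (h ▸ hi)
      simpa [Function.update_of_ne this] using hv i hi) (by
    rw [Finset.sum_insert hj, Function.update_self, Finset.sum_update_of_notMem hj]
    simpa using hm) j (Finset.mem_insert_self _ _)
  simpa using this

theorem IndepOver.disjoint (h : IndepOver M p D) {j : ι} (hj : j ∈ D) : Disjoint M (p j) := by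
  simpa using h.disjoint_sup (s := ∅) (by simp) hj (by simp)

theorem IndepOver.sup_of_insert {j : ι} (h : IndepOver M p D) (hj : j ∈ D)
    {D' : Set ι} (hD : D' ⊆ D) (hjD : j ∉ D') : IndepOver (M ⊔ p j) p D' := by
  classical
  intro s hs v hv hsum
  obtain ⟨m, hm, y, hy, hmy⟩ := Submodule.mem_sup.1 hsum
  have hjs : j ∉ s := fun h => hjD (hs h)
  have := h (insert j s) (by
      rw [Finset.coe_insert]
      exact Set.insert_subset hj (hs.trans hD)) (Function.update v j (-y)) (by
    intro i hi
    rcases Finset.mem_insert.1 hi with rfl | hi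
    · simpa using hy
    · have : i ≠ j := fun h => hjs (h ▸ hi)
      simpa [Function.update_of_ne this] using hv i hi) (by
    rw [Finset.sum_insert hjs, Function.update_self, Finset.sum_update_of_notMem hjs, ← hmy]
    simpa using hm)
  intro i hi
  have h1 := this i (Finset.mem_insert_of_mem hi)
  rwa [Function.update_of_ne (fun h : i = j => hjs (h ▸ hi))] at h1

/-- If the `Y s` lie in `X` and are independent over `M ≤ X`, and the `H s` are independent over
`X`, then the sums `Y s ⊔ H s` are independent over `M`. -/
theorem IndepOver.sup_family {X : Submodule A W} {Y H : ι → Submodule A W}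
    (hY : IndepOver M Y D) (hH : IndepOver X H D) (hM : M ≤ X) (hYX : ∀ s ∈ D, Y s ≤ X) :
    IndepOver M (fun s => Y s ⊔ H s) D := by
  intro s hs v hv hsum
  choose! a ha b hb hab using fun i hi => Submodule.mem_sup.1 (hv i hi)
  have h1 : ∑ i ∈ s, v i = ∑ i ∈ s, a i + ∑ i ∈ s, b i := by
    rw [← Finset.sum_add_distrib]
    exact Finset.sum_congr rfl fun i hi => (hab i hi).symm
  have h2 : ∀ i ∈ s, b i = 0 := by
    refine hH s hs b hb ?_
    have : ∑ i ∈ s, b i = ∑ i ∈ s, v i - ∑ i ∈ s, a i := by rw [h1]; abel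
    rw [this]
    exact X.sub_mem (hM hsum) (X.sum_mem fun i hi => hYX i (hs hi) (ha i hi))
  have h3 : ∀ i ∈ s, a i = 0 := by
    refine hY s hs a ha ?_
    rwa [h1, Finset.sum_eq_zero h2, add_zero] at hsum
  intro i hi
  rw [← hab i hi, h2 i hi, h3 i hi, add_zero]

theorem IndepOver.sigma {J : Type*} {q : J × ι → Submodule A W} {D : Set (J × ι)}
    (h : IndepOver M q D) {E : Set J} {t : J → Finset ι} (ht : ∀ j ∈ E, ∀ i ∈ t j, (j, i) ∈ D) :
    IndepOver M (fun j => (t j).sup fun i => q (j, i)) E := by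
  classical
  intro s hs v hv hsum
  choose! c hc hcv using fun j hj => (mem_finset_sup_iff _ _).1 (hv j hj)
  have h1 : ∀ x ∈ (s.sigma t).map (Equiv.sigmaEquivProd J ι).toEmbedding, c x.1 x.2 = 0 := by
    refine h _ ?_ (fun x => c x.1 x.2) ?_ ?_
    · intro x hx
      obtain ⟨⟨j, i⟩, hji, rfl⟩ := Finset.mem_map.1 hx
      obtain ⟨hj, hi⟩ := Finset.mem_sigma.1 hji
      exact ht j (hs hj) i hi
    · intro x hx
      obtain ⟨⟨j, i⟩, hji, rfl⟩ := Finset.mem_map.1 hx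
      obtain ⟨hj, hi⟩ := Finset.mem_sigma.1 hji
      exact hc j hj i hi
    · rw [Finset.sum_map, Finset.sum_sigma]
      convert hsum using 1
      exact Finset.sum_congr rfl fun j hj => hcv j hj
  intro j hj
  rw [← hcv j hj]
  refine Finset.sum_eq_zero fun i hi => h1 (j, i) ?_
  exact Finset.mem_map.2 ⟨⟨j, i⟩, Finset.mem_sigma.2 ⟨hj, hi⟩, rfl⟩

/-- A sequence of submodules, each disjoint from the sum of `M` and the earlier ones, is
independent over `M`. -/
theorem IndepOver.of_disjoint_nat {Q : ℕ → Submodule A W}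
    (h : ∀ n, Disjoint (M ⊔ (Finset.range n).sup Q) (Q n)) : IndepOver M Q Set.univ := by
  intro s _
  induction s using Finset.induction_on_max with
  | empty => simp
  | insert m s hm ih =>
    intro v hv hs
    have hms : m ∉ s := fun h' => lt_irrefl _ (hm m h')
    rw [Finset.sum_insert hms] at hs
    have hsum : ∑ i ∈ s, v i ∈ (Finset.range m).sup Q :=
      Submodule.sum_mem _ fun i hi =>
        (Finset.le_sup (f := Q) (Finset.mem_range.2 (hm i hi)))
          (hv i (Finset.mem_insert_of_mem hi))
    have h0 : v m = 0 := by
      refine Submodule.disjoint_def.1 (h m) _ ?_ (hv m (Finset.mem_insert_self _ _))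
      have : v m = (v m + ∑ i ∈ s, v i) - ∑ i ∈ s, v i := by abel
      rw [this]
      exact Submodule.sub_mem _ (Submodule.mem_sup_left hs) (Submodule.mem_sup_right hsum)
    rw [h0, zero_add] at hs
    intro i hi
    rcases Finset.mem_insert.1 hi with rfl | hi
    · exact h0
    · exact ih (Set.subset_univ _) v (fun i hi => hv i (Finset.mem_insert_of_mem hi)) hs i hi

end

/-- Replacing `u` by `u + v`, where `v` takes values in `Z`, does not change its position
relative to `Z`. -/
theorem disjoint_range_add {A N W : Type*} [Ring A] [AddCommGroup W] [Module A W]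
    [AddCommGroup N] [Module A N] {Z : Submodule A W} {u v : N →ₗ[A] W}
    (hu : Function.Injective u) (hd : Disjoint Z (LinearMap.range u))
    (hv : LinearMap.range v ≤ Z) :
    Disjoint Z (LinearMap.range (u + v)) ∧
      Z ⊔ LinearMap.range (u + v) = Z ⊔ LinearMap.range u := by
  have hvy : ∀ y, v y ∈ Z := fun y => hv ⟨y, rfl⟩
  refine ⟨?_, le_antisymm (sup_le le_sup_left ?_) (sup_le le_sup_left ?_)⟩
  · rw [Submodule.disjoint_def]
    rintro _ hx ⟨y, rfl⟩
    have h1 : u y ∈ Z := by simpa using Z.sub_mem hx (hvy y)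
    have h2 : u y = 0 := Submodule.disjoint_def.1 hd _ h1 ⟨y, rfl⟩
    rw [(map_eq_zero_iff u hu).1 h2, map_zero]
  · rintro _ ⟨y, rfl⟩
    rw [LinearMap.add_apply, add_comm]
    exact Submodule.add_mem_sup (hvy y) ⟨y, rfl⟩
  · rintro _ ⟨y, rfl⟩
    refine Submodule.mem_sup.2 ⟨-v y, Z.neg_mem (hvy y), _, ⟨y, rfl⟩, ?_⟩
    simp

theorem injective_coprod_subtype {A W : Type*} [Ring A] [AddCommGroup W] [Module A W]
    {P Q : Submodule A W} (h : Disjoint P Q) :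
    Function.Injective (P.subtype.coprod Q.subtype) := by
  rw [← LinearMap.ker_eq_bot, LinearMap.ker_coprod_of_disjoint_range]
  · simp
  · simpa using h

theorem injective_domRestrict_of_disjoint {A W W' : Type*} [Ring A] [AddCommGroup W] [Module A W]
    [AddCommGroup W'] [Module A W'] {P : Submodule A W} {j : W →ₗ[A] W'}
    (hj : Disjoint P (LinearMap.ker j)) : Function.Injective (j.domRestrict P) := by
  rw [← LinearMap.ker_eq_bot, LinearMap.ker_eq_bot']
  intro x hx
  exact Subtype.ext (Submodule.disjoint_def.1 hj x x.2 hx)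

/-! ### Finite direct sums of members of a class of bimodules -/

variable {K : Set (Bimod R S T)}

theorem isSumOfFew_iff {P : Type u} [AddCommGroup P] [Module (BiRing R S T) P] :
    IsSumOfFew K ℵ₀ P ↔ ∃ (J : Type u) (X : J → Bimod R S T), Finite J ∧ (∀ i, X i ∈ K) ∧
      Nonempty (P ≃ₗ[BiRing R S T] ∀ i, X i) := by
  classical
  constructor
  · rintro ⟨J, X, hJ, hX, ⟨φ⟩⟩
    have : Finite J := Cardinal.lt_aleph0_iff_finite.1 hJ
    have := Fintype.ofFinite J
    exact ⟨J, X, ‹_›, hX, ⟨φ.trans (DirectSum.linearEquivFunOnFintype _ _ _)⟩⟩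
  · rintro ⟨J, X, hJ, hX, ⟨φ⟩⟩
    have := Fintype.ofFinite J
    exact ⟨J, X, Cardinal.lt_aleph0_iff_finite.2 hJ, hX,
      ⟨φ.trans (DirectSum.linearEquivFunOnFintype _ _ _).symm⟩⟩

theorem IsSumOfFew.congr {P Q : Type u} [AddCommGroup P] [Module (BiRing R S T) P]
    [AddCommGroup Q] [Module (BiRing R S T) Q] (h : IsSumOfFew K ℵ₀ P)
    (φ : Q ≃ₗ[BiRing R S T] P) : IsSumOfFew K ℵ₀ Q := by
  obtain ⟨J, X, hJ, hX, ⟨ψ⟩⟩ := h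
  exact ⟨J, X, hJ, hX, ⟨φ.trans ψ⟩⟩

theorem IsSumOfFew.of_mem {P : Type u} [AddCommGroup P] [Module (BiRing R S T) P]
    {X : Bimod R S T} (hX : X ∈ K) (φ : P ≃ₗ[BiRing R S T] X) : IsSumOfFew K ℵ₀ P :=
  isSumOfFew_iff.2 ⟨PUnit, fun _ => X, inferInstance, fun _ => hX,
    ⟨φ.trans (LinearEquiv.funUnique PUnit (BiRing R S T) X).symm⟩⟩

section

variable {W : Type u} [AddCommGroup W] [Module (BiRing R S T) W]
  {W' : Type u} [AddCommGroup W'] [Module (BiRing R S T) W']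

theorem IsSumOfFew.bot : IsSumOfFew K ℵ₀ (⊥ : Submodule (BiRing R S T) W) :=
  isSumOfFew_iff.2 ⟨PEmpty, fun x => x.elim, inferInstance, fun x => x.elim,
    ⟨LinearEquiv.ofSubsingleton _ _⟩⟩

theorem IsSumOfFew.sup {P Q : Submodule (BiRing R S T) W} (hP : IsSumOfFew K ℵ₀ P)
    (hQ : IsSumOfFew K ℵ₀ Q) (h : Disjoint P Q) : IsSumOfFew K ℵ₀ ↥(P ⊔ Q) := by
  obtain ⟨J, X, hJ, hX, ⟨φ⟩⟩ := isSumOfFew_iff.1 hP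
  obtain ⟨J', X', hJ', hX', ⟨φ'⟩⟩ := isSumOfFew_iff.1 hQ
  refine isSumOfFew_iff.2 ⟨J ⊕ J', fun x => Sum.elim X X' x, inferInstance, ?_, ⟨?_⟩⟩
  · rintro (i | i)
    exacts [hX i, hX' i]
  · have h1 : Function.Injective (P.subtype.coprod Q.subtype) := injective_coprod_subtype h
    have h2 : LinearMap.range (P.subtype.coprod Q.subtype) = P ⊔ Q := by
      rw [LinearMap.range_coprod]; simp
    exact ((LinearEquiv.ofEq _ _ h2.symm).trans (LinearEquiv.ofInjective _ h1).symm).trans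
      ((φ.prodCongr φ').trans
        (LinearEquiv.sumPiEquivProdPi (BiRing R S T) J J'
          (fun x => (Sum.elim X X' x : Bimod R S T))).symm)

theorem IsSumOfFew.range {X : Bimod R S T} (hX : X ∈ K) {h : X →ₗ[BiRing R S T] W}
    (hh : Function.Injective h) : IsSumOfFew K ℵ₀ (LinearMap.range h) :=
  IsSumOfFew.of_mem hX (LinearEquiv.ofInjective h hh).symm

theorem IsSumOfFew.map {P : Submodule (BiRing R S T) W} (hP : IsSumOfFew K ℵ₀ P)
    {j : W →ₗ[BiRing R S T] W'} (hj : Disjoint P (LinearMap.ker j)) :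
    IsSumOfFew K ℵ₀ (P.map j) := by
  have h1 : Function.Injective (j.domRestrict P) := injective_domRestrict_of_disjoint hj
  have h2 : LinearMap.range (j.domRestrict P) = P.map j := by
    rw [LinearMap.range_domRestrict]
  exact hP.congr ((LinearEquiv.ofEq _ _ h2.symm).trans (LinearEquiv.ofInjective _ h1).symm)

/-! ### Almost direct summands without strategies -/

/-- A positional description of almost direct summands: `F` is a set of positions `X` of the game
(the sum of `M₁` and of the moves of player II so far) which are safe for player II, that is, every
element of `M₂` can be absorbed by a finite direct sum leading to another safe position. -/
def Good (K : Set (Bimod R S T)) (M₁ M₂ : Submodule (BiRing R S T) W) : Prop :=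
  ∃ F : Set (Submodule (BiRing R S T) W), M₁ ∈ F ∧ ∀ X ∈ F, X ≤ M₂ ∧ ∀ v ∈ M₂,
    ∃ P : Submodule (BiRing R S T) W, IsSumOfFew K ℵ₀ P ∧ Disjoint X P ∧ v ∈ X ⊔ P ∧ X ⊔ P ∈ F

variable {M₁ M₂ M₃ : Submodule (BiRing R S T) W}

theorem Good.le (h : Good K M₁ M₂) : M₁ ≤ M₂ := by
  obtain ⟨F, h1, h2⟩ := h
  exact (h2 _ h1).1

theorem Good.exists_extension (h : Good K M₁ M₂) {v : W} (hv : v ∈ M₂) :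
    ∃ P : Submodule (BiRing R S T) W, IsSumOfFew K ℵ₀ P ∧ Disjoint M₁ P ∧ v ∈ M₁ ⊔ P ∧
      Good K (M₁ ⊔ P) M₂ := by
  obtain ⟨F, h1, h2⟩ := h
  obtain ⟨P, hP, hd, hv, hF⟩ := (h2 _ h1).2 v hv
  exact ⟨P, hP, hd, hv, F, hF, h2⟩

/-- Coinduction for `Good`. -/
theorem Good.coind (F : Submodule (BiRing R S T) W → Prop) (h1 : F M₁)
    (hle : ∀ X, F X → X ≤ M₂)
    (h : ∀ X, F X → ∀ v ∈ M₂, ∃ P : Submodule (BiRing R S T) W, IsSumOfFew K ℵ₀ P ∧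
      Disjoint X P ∧ v ∈ X ⊔ P ∧ F (X ⊔ P)) : Good K M₁ M₂ :=
  ⟨{X | F X}, h1, fun X hX => ⟨hle X hX, h X hX⟩⟩

theorem Good.exists_extension_finite (h : Good K M₁ M₂) {A : Set W} (hA : A.Finite)
    (hAM : A ⊆ M₂) :
    ∃ P : Submodule (BiRing R S T) W, IsSumOfFew K ℵ₀ P ∧ Disjoint M₁ P ∧
      A ⊆ (M₁ ⊔ P : Submodule (BiRing R S T) W) ∧ Good K (M₁ ⊔ P) M₂ := by
  induction A, hA using Set.Finite.induction_on with
  | empty => exact ⟨⊥, IsSumOfFew.bot, disjoint_bot_right, by simp, by simpa using h⟩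
  | @insert a A ha hA ih =>
    obtain ⟨P, hP, hd, hAP, hg⟩ := ih ((Set.subset_insert _ _).trans hAM)
    obtain ⟨P', hP', hd', haP, hg'⟩ := hg.exists_extension (hAM (Set.mem_insert a A))
    refine ⟨P ⊔ P', hP.sup hP' (hd'.mono_left le_sup_right),
      hd.disjoint_sup_right_of_disjoint_sup_left hd', ?_, by rwa [← sup_assoc]⟩
    rw [← sup_assoc]
    rintro b (rfl | hb)
    · exact haP
    · exact (le_sup_left : M₁ ⊔ P ≤ M₁ ⊔ P ⊔ P') (hAP hb)

theorem Good.refl (M : Submodule (BiRing R S T) W) : Good K M M :=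
  .coind (fun X => X = M) rfl (fun X h => h.le) fun X h v hv =>
    ⟨⊥, IsSumOfFew.bot, disjoint_bot_right, by simpa [h] using hv, by simpa using h⟩

theorem Good.sup_right {P : Submodule (BiRing R S T) W} (hP : IsSumOfFew K ℵ₀ P)
    (h : Disjoint M₁ P) : Good K M₁ (M₁ ⊔ P) := by
  refine .coind (fun X => X = M₁ ∨ X = M₁ ⊔ P) (.inl rfl) ?_ ?_
  · rintro X (rfl | rfl)
    exacts [le_sup_left, le_rfl]
  · rintro X (rfl | rfl) v hv
    · exact ⟨P, hP, h, hv, .inr rfl⟩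
    · exact ⟨⊥, IsSumOfFew.bot, disjoint_bot_right, by simpa using hv, by simp⟩

/-- The image of an almost direct summand `B` of `M` under a homomorphism `j`, enlarged to a
submodule `U` which contains nothing new from `M`, is an almost direct summand of `U ⊔ j M`.  This
covers pushouts as well as the addition of a direct summand. -/
theorem Good.push {B M : Submodule (BiRing R S T) W} (h : Good K B M)
    (j : W →ₗ[BiRing R S T] W') {U : Submodule (BiRing R S T) W'} (hU : B.map j ≤ U)
    (hB : ∀ b ∈ M, j b ∈ U → b ∈ B) : Good K U (U ⊔ M.map j) := by
  refine .coind (fun Y => ∃ X, Good K X M ∧ B ≤ X ∧ Y = U ⊔ X.map j)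
    ⟨B, h, le_rfl, by simpa using hU⟩ ?_ ?_
  · rintro Y ⟨X, hX, -, rfl⟩
    exact sup_le_sup_left (Submodule.map_mono hX.le) _
  · rintro Y ⟨X, hX, hBX, rfl⟩ v hv
    obtain ⟨a, ha, y, ⟨b, hb, rfl⟩, rfl⟩ := Submodule.mem_sup.1 hv
    obtain ⟨P, hP, hd, hbP, hg⟩ := hX.exists_extension hb
    have hPM : P ≤ M := le_sup_right.trans hg.le
    have key : ∀ c ∈ P, j c ∈ U ⊔ X.map j → c = 0 := by
      intro c hc hjc
      obtain ⟨a, ha, y, ⟨x, hx, rfl⟩, hax⟩ := Submodule.mem_sup.1 hjc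
      refine Submodule.disjoint_def.1 hd c ?_ hc
      have h1 : c - x ∈ B := by
        refine hB _ (M.sub_mem (hPM hc) (hX.le hx)) ?_
        rw [map_sub, ← hax]
        simpa using ha
      simpa using X.add_mem (hBX h1) hx
    refine ⟨P.map j, hP.map ?_, ?_, ?_, X ⊔ P, hg, hBX.trans le_sup_left, ?_⟩
    · rw [Submodule.disjoint_def]
      intro c hc hc0
      exact key c hc (by rw [LinearMap.mem_ker.1 hc0]; exact Submodule.zero_mem _)
    · rw [Submodule.disjoint_def]
      rintro _ h1 ⟨c, hc, rfl⟩
      rw [key c hc h1, map_zero]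
    · rw [sup_assoc, ← Submodule.map_sup]
      exact Submodule.add_mem_sup ha (Submodule.mem_map_of_mem hbP)
    · rw [Submodule.map_sup, sup_assoc]

theorem Good.sup_disjoint {B M : Submodule (BiRing R S T) W} (h : Good K B M)
    {Z : Submodule (BiRing R S T) W} (hZ : Disjoint M Z) : Good K (B ⊔ Z) (M ⊔ Z) := by
  have := h.push (U := B ⊔ Z) LinearMap.id (by simp) (by
    intro b hb hbZ
    obtain ⟨x, hx, z, hz, rfl⟩ := Submodule.mem_sup.1 hbZ
    have : z = 0 := by
      refine Submodule.disjoint_def.1 hZ z ?_ hz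
      simpa using M.sub_mem hb (h.le hx)
    simpa [this] using hx)
  rwa [Submodule.map_id, sup_right_comm, sup_eq_right.2 h.le] at this

theorem Good.map {B M : Submodule (BiRing R S T) W} (h : Good K B M)
    {j : W →ₗ[BiRing R S T] W'} (hj : Function.Injective j) : Good K (B.map j) (M.map j) := by
  have := h.push (U := B.map j) j le_rfl (by
    rintro b - ⟨c, hc, hcb⟩
    rwa [← hj hcb])
  rwa [sup_eq_right.2 (Submodule.map_mono h.le)] at this

theorem Good.trans (h : Good K M₁ M₂) (h' : Good K M₂ M₃) : Good K M₁ M₃ := by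
  refine .coind (fun Z => ∃ Y, Good K Z Y ∧ Good K Y M₃) ⟨M₂, h, h'⟩ ?_ ?_
  · rintro Z ⟨Y, h1, h2⟩
    exact h1.le.trans h2.le
  · rintro Z ⟨Y, h1, h2⟩ v hv
    obtain ⟨P, hP, hd, hvP, hg⟩ := h2.exists_extension hv
    obtain ⟨P', hP', hd', hvP', hg'⟩ := (h1.sup_disjoint hd).exists_extension hvP
    refine ⟨P ⊔ P', hP.sup hP' (hd'.mono_left le_sup_right),
      (hd.mono_left h1.le).disjoint_sup_right_of_disjoint_sup_left hd', ?_, Y ⊔ P, ?_, hg⟩ <;>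
    rwa [← sup_assoc]

/-- If every `D x` in a family can be enlarged inside the family, as an almost direct summand, so
as to contain any given element of `M`, then every `D x` is an almost direct summand of `M`. -/
theorem Good.of_family {X : Type*} (D : X → Submodule (BiRing R S T) W)
    {M : Submodule (BiRing R S T) W} (hD : ∀ x, D x ≤ M)
    (h : ∀ x, ∀ v ∈ M, ∃ y, v ∈ D y ∧ Good K (D x) (D y)) (x : X) : Good K (D x) M := by
  refine .coind (fun Q => ∃ x, Good K Q (D x)) ⟨x, .refl _⟩ ?_ ?_
  · rintro Q ⟨x, hx⟩
    exact hx.le.trans (hD x)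
  · rintro Q ⟨x, hx⟩ v hv
    obtain ⟨y, hvy, hxy⟩ := h x v hv
    obtain ⟨P, hP, hd, hvP, hg⟩ := (hx.trans hxy).exists_extension hvy
    exact ⟨P, hP, hd, hvP, y, hg⟩

theorem IndepOver.good_finset {ι : Type*} {M : Submodule (BiRing R S T) W}
    {p : ι → Submodule (BiRing R S T) W} {D : Set ι} (h : IndepOver M p D)
    (hp : ∀ i ∈ D, IsSumOfFew K ℵ₀ (p i)) {s t : Finset ι} (hst : s ⊆ t) (ht : ↑t ⊆ D) :
    Good K (M ⊔ s.sup p) (M ⊔ t.sup p) := by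
  classical
  induction t using Finset.induction_on generalizing s with
  | empty => rw [Finset.subset_empty.1 hst]; exact .refl _
  | insert a t ha ih =>
    rw [Finset.coe_insert, Set.insert_subset_iff] at ht
    rw [Finset.sup_insert, sup_comm (p a), ← sup_assoc]
    have hd := h.disjoint_sup ht.2 ht.1 ha
    by_cases has : a ∈ s
    · have h1 := ih (s := s.erase a) (by rwa [← Finset.subset_insert_iff]) ht.2
      rw [← Finset.insert_erase has, Finset.sup_insert, sup_comm (p a), ← sup_assoc]
      exact h1.sup_disjoint hd
    · exact (ih ((Finset.subset_insert_iff_of_notMem has).1 hst) ht.2).trans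
        (.sup_right (hp a ht.1) hd)

theorem IndepOver.good {ι : Type*} {M : Submodule (BiRing R S T) W}
    {p : ι → Submodule (BiRing R S T) W} {D : Set ι} (h : IndepOver M p D)
    (hp : ∀ i ∈ D, IsSumOfFew K ℵ₀ (p i)) (s : Finset ι) (hs : ↑s ⊆ D) :
    Good K (M ⊔ s.sup p) (M ⊔ ⨆ i ∈ D, p i) := by
  classical
  refine Good.of_family (fun s : {s : Finset ι // ↑s ⊆ D} => M ⊔ s.1.sup p) ?_ ?_ ⟨s, hs⟩
  · exact fun s => sup_le_sup_left (Finset.sup_le fun i hi => le_biSup p (s.2 hi)) _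
  · rintro ⟨s, hs⟩ v hv
    obtain ⟨m, hm, y, hy, rfl⟩ := Submodule.mem_sup.1 hv
    rw [iSup_subtype'] at hy
    obtain ⟨t, ht⟩ := Submodule.mem_iSup_iff_exists_finset.1 hy
    have htD : (↑(t.map (Function.Embedding.subtype (· ∈ D))) : Set ι) ⊆ D := by
      intro i hi
      obtain ⟨j, -, rfl⟩ := Finset.mem_map.1 hi
      exact j.2
    have hu : (↑(s ∪ t.map (Function.Embedding.subtype (· ∈ D))) : Set ι) ⊆ D := by
      rw [Finset.coe_union]
      exact Set.union_subset hs htD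
    refine ⟨⟨_, hu⟩, ?_, h.good_finset hp Finset.subset_union_left hu⟩
    refine Submodule.add_mem_sup hm ?_
    rw [Finset.sup_union, Finset.sup_map]
    refine Submodule.mem_sup_right ?_
    rw [← Finset.sup_eq_iSup] at ht
    exact ht

/-! ### Equivalence with winning strategies -/

theorem AlmostSummand.good (h : AlmostSummand K ℵ₀ M₁ M₂) : Good K M₁ M₂ := by
  classical
  obtain ⟨hle, σ, hσ⟩ := h
  -- a finite list of moves of player I is continued by empty moves
  let mv : List (Set W) → ℕ → Set W := fun l n => l.getD n ∅
  let Q : List (Set W) → ℕ → Submodule (BiRing R S T) W :=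
    fun l n => σ ((List.range (n + 1)).map (mv l))
  let X : List (Set W) → Submodule (BiRing R S T) W :=
    fun l => M₁ ⊔ (Finset.range l.length).sup (Q l)
  let legal : List (Set W) → Prop := fun l => ∀ A ∈ l, A ⊆ (M₂ : Set W) ∧ #A < ℵ₀
  have hlegal : ∀ l, legal l → ∀ n, mv l n ⊆ (M₂ : Set W) ∧ #(mv l n) < ℵ₀ := by
    intro l hl n
    by_cases hn : n < l.length
    · have : mv l n = l[n] := by simp [mv, hn]
      rw [this]
      exact hl _ (List.getElem_mem hn)
    · have : mv l n = ∅ := by simp [mv, Nat.le_of_not_lt hn]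
      rw [this]
      simp [Cardinal.aleph0_pos]
  have hplay := fun l hl => hσ (mv l) (hlegal l hl) (Q l) fun n => rfl
  refine .coind (fun Y => ∃ l, legal l ∧ Y = X l) ⟨[], by simp [legal], by simp [X]⟩ ?_ ?_
  · rintro Y ⟨l, hl, rfl⟩
    exact sup_le hle (Finset.sup_le fun n _ => (hplay l hl).1 n)
  · rintro Y ⟨l, hl, rfl⟩ v hv
    have hl' : legal (l ++ [{v}]) := by
      intro A hA
      rcases List.mem_append.1 hA with hA | hA
      · exact hl A hA
      · rw [List.mem_singleton.1 hA]
        exact ⟨by simpa using hv, by simp⟩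
    have hQ : ∀ n < l.length, Q (l ++ [{v}]) n = Q l n := by
      intro n hn
      simp only [Q]
      congr 1
      refine List.map_congr_left fun k hk => ?_
      have : k < l.length := by
        have := List.mem_range.1 hk
        omega
      simp [mv, List.getElem?_append_left this]
    have hX : X l = M₁ ⊔ (Finset.range l.length).sup (Q (l ++ [{v}])) := by
      simp only [X]
      congr 1
      exact Finset.sup_congr rfl fun n hn => (hQ n (Finset.mem_range.1 hn)).symm
    have hX' : X l ⊔ Q (l ++ [{v}]) l.length = X (l ++ [{v}]) := by
      rw [hX]
      simp only [X, List.length_append, List.length_singleton, Finset.range_add_one,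
        Finset.sup_insert]
      rw [sup_assoc, sup_comm (Q _ _)]
    obtain ⟨-, h2, h3, h4⟩ := hplay _ hl'
    have hd : Disjoint (X l) (Q (l ++ [{v}]) l.length) := by
      rw [hX]
      exact (IndepOver.of_iSupIndep h4).disjoint_sup (Set.subset_univ _) (Set.mem_univ _) (by simp)
    have hv' : v ∈ mv (l ++ [{v}]) l.length := by simp [mv]
    have hvX : v ∈ X l ⊔ Q (l ++ [{v}]) l.length := by
      rw [hX']
      refine (sup_le_sup_left (iSup₂_le fun n hn => ?_) M₁) (h2 _ hv')
      refine Finset.le_sup (f := Q (l ++ [{v}])) (Finset.mem_range.2 ?_)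
      rw [List.length_append, List.length_singleton]
      omega
    have hPs := h3 l.length
    clear_value X Q
    refine ⟨Q (l ++ [{v}]) l.length, ?_, ?_, ?_, ?_⟩
    · exact hPs
    · exact hd
    · exact hvX
    · exact ⟨l ++ [{v}], hl', hX'⟩

theorem Good.almostSummand (h : Good K M₁ M₂) : AlmostSummand K ℵ₀ M₁ M₂ := by
  classical
  have hext := fun (X : {X : Submodule (BiRing R S T) W // Good K X M₂})
      (A : {A : Set W // A.Finite ∧ A ⊆ M₂}) => X.2.exists_extension_finite A.2.1 A.2.2
  choose P hP hd hA hg using hext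
  let st : {X : Submodule (BiRing R S T) W // Good K X M₂} → Set W →
      {X : Submodule (BiRing R S T) W // Good K X M₂} := fun X A =>
    if h : A.Finite ∧ A ⊆ M₂ then ⟨X.1 ⊔ P X ⟨A, h⟩, hg X ⟨A, h⟩⟩ else X
  let ans : {X : Submodule (BiRing R S T) W // Good K X M₂} → Set W →
      Submodule (BiRing R S T) W := fun X A =>
    if h : A.Finite ∧ A ⊆ M₂ then P X ⟨A, h⟩ else ⊥
  refine ⟨h.le, fun l => ans (l.dropLast.foldl st ⟨M₁, h⟩) (l.getLast?.getD ∅), ?_⟩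
  intro A hAc Q hQ
  have hAc' : ∀ n, (A n).Finite ∧ A n ⊆ M₂ := fun n =>
    ⟨Set.finite_coe_iff.1 (Cardinal.lt_aleph0_iff_finite.1 (hAc n).2), (hAc n).1⟩
  let Y : ℕ → {X : Submodule (BiRing R S T) W // Good K X M₂} :=
    fun n => ((List.range n).map A).foldl st ⟨M₁, h⟩
  have hQ' : ∀ n, Q n = P (Y n) ⟨A n, hAc' n⟩ := by
    intro n
    rw [hQ n, List.range_succ, List.map_append]
    simp [ans, Y, hAc' n]
  have hY : ∀ n, (Y (n + 1)).1 = (Y n).1 ⊔ Q n := by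
    intro n
    have : Y (n + 1) = st (Y n) (A n) := by
      simp [Y, List.range_succ]
    rw [this, hQ']
    simp [st, hAc' n]
  have hY' : ∀ n, (Y n).1 = M₁ ⊔ (Finset.range n).sup Q := by
    intro n
    induction n with
    | zero => simp [Y]
    | succ n ih => rw [hY, ih, Finset.range_add_one, Finset.sup_insert, sup_assoc, sup_comm (Q n)]
  refine ⟨fun n => ?_, fun n => ?_, fun n => ?_, ?_⟩
  · exact (le_sup_right.trans (hY n).ge).trans (Y (n + 1)).2.le
  · have h1 := hA (Y n) ⟨A n, hAc' n⟩
    rw [← hQ', ← hY, hY'] at h1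
    refine h1.trans (show _ ≤ _ from sup_le_sup_left (Finset.sup_le fun l hl => ?_) M₁)
    exact le_iSup₂_of_le l (Nat.lt_succ_iff.1 (Finset.mem_range.1 hl)) le_rfl
  · rw [hQ']
    exact hP _ _
  · refine IndepOver.iSupIndep (IndepOver.of_disjoint_nat fun n => ?_)
    rw [← hY', hQ']
    exact hd _ _

theorem almostSummand_iff : AlmostSummand K ℵ₀ M₁ M₂ ↔ Good K M₁ M₂ :=
  ⟨AlmostSummand.good, Good.almostSummand⟩

end

/-! ### The subgroups `φₙ` -/

section

variable {K : Set (Bimod R S T)} {e : ESystem R S T} {n : ℕ}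
  {W : Type u} [AddCommGroup W] [Module (BiRing R S T) W]
  {U : Type u} [AddCommGroup U] [Module (BiRing R S T) U]

theorem mem_phi_iff {w : W} : w ∈ phi K e n W ↔
    ∃ (W' : Bimod R S T) (i : W →ₗ[BiRing R S T] W'), Function.Injective i ∧
      Good K (LinearMap.range i) ⊤ ∧
      ∃ v : e.N n →+ W', IsRLinear (R := R) (S := S) (T := T) v ∧ v (e.x n) = i w := by
  simp only [phi, Set.mem_ofPred_eq, almostSummand_iff]

theorem IsRLinear.comp {V V' V'' : Type u} [AddCommGroup V] [Module (BiRing R S T) V]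
    [AddCommGroup V'] [Module (BiRing R S T) V'] [AddCommGroup V''] [Module (BiRing R S T) V'']
    {g : V' →+ V''} {f : V →+ V'} (hg : IsRLinear (R := R) (S := S) (T := T) g)
    (hf : IsRLinear (R := R) (S := S) (T := T) f) :
    IsRLinear (R := R) (S := S) (T := T) (g.comp f) := by
  intro r v
  rw [AddMonoidHom.comp_apply, hf r v, hg r (f v), AddMonoidHom.comp_apply]

theorem IsRLinear.of_linearMap {V V' : Type u} [AddCommGroup V] [Module (BiRing R S T) V]
    [AddCommGroup V'] [Module (BiRing R S T) V'] (f : V →ₗ[BiRing R S T] V') :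
    IsRLinear (R := R) (S := S) (T := T) f.toAddMonoidHom :=
  fun _ _ => f.map_smul _ _

theorem IsRLinear.sub {V V' : Type u} [AddCommGroup V] [Module (BiRing R S T) V]
    [AddCommGroup V'] [Module (BiRing R S T) V'] {f g : V →+ V'}
    (hf : IsRLinear (R := R) (S := S) (T := T) f)
    (hg : IsRLinear (R := R) (S := S) (T := T) g) :
    IsRLinear (R := R) (S := S) (T := T) (f - g) := by
  intro r v
  rw [AddMonoidHom.sub_apply, AddMonoidHom.sub_apply, hf r v, hg r v, smul_sub]

theorem mem_phi_of_hom (v : e.N n →+ W) (hv : IsRLinear (R := R) (S := S) (T := T) v) :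
    v (e.x n) ∈ phi K e n W := by
  refine mem_phi_iff.2 ⟨ModuleCat.of _ W, LinearMap.id, Function.injective_id, ?_, v, hv, rfl⟩
  rw [LinearMap.range_id]
  exact .refl _

/-- The pushout of an injective homomorphism `i` along `u`. -/
theorem exists_pushout {A W W' U : Type u} [Ring A] [AddCommGroup W] [Module A W]
    [AddCommGroup W'] [Module A W'] [AddCommGroup U] [Module A U] (i : W →ₗ[A] W')
    (hi : Function.Injective i) (u : W →ₗ[A] U) :
    ∃ (X : ModuleCat.{u} A) (jU : U →ₗ[A] X) (jW : W' →ₗ[A] X), Function.Injective jU ∧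
      (∀ w, jW (i w) = jU (u w)) ∧
      (∀ b, jW b ∈ LinearMap.range jU → b ∈ LinearMap.range i) ∧
      LinearMap.range jU ⊔ LinearMap.range jW = ⊤ := by
  let D : Submodule A (U × W') := LinearMap.range (u.prod (-i))
  refine ⟨ModuleCat.of A ((U × W') ⧸ D), D.mkQ.comp (LinearMap.inl A U W'),
    D.mkQ.comp (LinearMap.inr A U W'), ?_, ?_, ?_, ?_⟩
  · rw [← LinearMap.ker_eq_bot, LinearMap.ker_eq_bot']
    intro a ha
    obtain ⟨w, hw⟩ := (Submodule.Quotient.mk_eq_zero D).1 ha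
    rw [LinearMap.prod_apply] at hw
    have h2 : i w = 0 := by simpa using (Prod.ext_iff.1 hw).2
    have h1 : u w = a := (Prod.ext_iff.1 hw).1
    rw [← h1, (map_eq_zero_iff i hi).1 h2, map_zero]
  · intro w
    refine (Submodule.Quotient.eq D).2 ⟨-w, ?_⟩
    simp
  · rintro b ⟨a, ha⟩
    obtain ⟨w, hw⟩ := (Submodule.Quotient.eq D).1 ha
    refine ⟨w, ?_⟩
    simpa using (Prod.ext_iff.1 hw).2
  · rw [eq_top_iff]
    rintro x -
    obtain ⟨⟨a, b⟩, rfl⟩ := Submodule.Quotient.mk_surjective D x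
    refine Submodule.mem_sup.2 ⟨_, ⟨a, rfl⟩, _, ⟨b, rfl⟩, ?_⟩
    have : ((a, b) : U × W') = (a, 0) + (0, b) := by simp
    rw [this]
    rfl

theorem phi_map (u : W →ₗ[BiRing R S T] U) {w : W} (hw : w ∈ phi K e n W) :
    u w ∈ phi K e n U := by
  obtain ⟨W', i, hi, hg, v, hv, hvw⟩ := mem_phi_iff.1 hw
  obtain ⟨X, jU, jW, hj, hc, hb, ht⟩ := exists_pushout i hi u
  refine mem_phi_iff.2 ⟨X, jU, hj, ?_, jW.toAddMonoidHom.comp v,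
    (IsRLinear.of_linearMap jW).comp hv, ?_⟩
  · have := hg.push jW (U := LinearMap.range jU) ?_ (fun b _ => hb b)
    · rwa [Submodule.map_top, ht] at this
    · rintro _ ⟨_, ⟨w, rfl⟩, rfl⟩
      exact ⟨u w, (hc w).symm⟩
  · rw [← hc, ← hvw]
    rfl

theorem phi_of_good {i : W →ₗ[BiRing R S T] U} (hi : Function.Injective i)
    (hg : Good K (LinearMap.range i) ⊤) {w : W} (hw : i w ∈ phi K e n U) : w ∈ phi K e n W := by
  obtain ⟨W', j, hj, hg', v, hv, hvw⟩ := mem_phi_iff.1 hw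
  refine mem_phi_iff.2 ⟨W', j.comp i, hj.comp hi, ?_, v, hv, hvw⟩
  have h1 := hg.map hj
  rw [Submodule.map_top] at h1
  rw [LinearMap.range_comp]
  exact h1.trans hg'

theorem sub_mem_phi {w₁ w₂ : W} (h₁ : w₁ ∈ phi K e n W) (h₂ : w₂ ∈ phi K e n W) :
    w₁ - w₂ ∈ phi K e n W := by
  obtain ⟨W₁, i, hi, hg, v, hv, hvw⟩ := mem_phi_iff.1 h₁
  obtain ⟨W₂, j, hj, hg', v', hv', hvw'⟩ := mem_phi_iff.1 (phi_map i h₂)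
  refine phi_of_good (i := j.comp i) (hj.comp hi) ?_ ?_
  · have h1 := hg.map hj
    rw [Submodule.map_top] at h1
    rw [LinearMap.range_comp]
    exact h1.trans hg'
  · have : j.comp i (w₁ - w₂) = (j.toAddMonoidHom.comp v - v') (e.x n) := by
      rw [AddMonoidHom.sub_apply, hvw', AddMonoidHom.comp_apply, hvw, map_sub]
      rfl
    rw [this]
    exact mem_phi_of_hom _ (((IsRLinear.of_linearMap j).comp hv).sub hv')

theorem phi_antitone : Antitone fun n => phi K e n W := by
  refine antitone_nat_of_succ_le fun n w hw => ?_
  obtain ⟨W', i, hi, hg, v, hv, hvw⟩ := mem_phi_iff.1 hw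
  refine mem_phi_iff.2 ⟨W', i, hi, hg, v.comp (e.g n).toAddMonoidHom,
    hv.comp (IsRLinear.of_linearMap _), ?_⟩
  rw [← hvw, ← e.g_x]
  rfl

theorem exists_projection {A V N : Type*} [Ring A] [AddCommGroup V] [Module A V]
    [AddCommGroup N] [Module A N] {Z : Submodule A V} {h : N →ₗ[A] V}
    (hh : Function.Injective h) (hd : Disjoint Z (LinearMap.range h)) :
    ∃ p : ↥(Z ⊔ LinearMap.range h) →ₗ[A] N, ∀ z ∈ Z, ∀ y (hm : z + h y ∈ Z ⊔ LinearMap.range h),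
      p ⟨z + h y, hm⟩ = y := by
  have h1 : Function.Injective (Z.subtype.coprod h) := by
    rw [← LinearMap.ker_eq_bot, LinearMap.ker_coprod_of_disjoint_range]
    · simp [LinearMap.ker_eq_bot.2 hh]
    · simpa using hd
  have h2 : Z ⊔ LinearMap.range h = LinearMap.range (Z.subtype.coprod h) := by
    rw [LinearMap.range_coprod]; simp
  let φ := (LinearEquiv.ofEq _ _ h2).trans (LinearEquiv.ofInjective _ h1).symm
  refine ⟨(LinearMap.snd A Z N).comp φ.toLinearMap, fun z hz y hm => ?_⟩
  have : φ ⟨z + h y, hm⟩ = (⟨z, hz⟩, y) := by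
    rw [LinearEquiv.trans_apply, LinearEquiv.symm_apply_eq]
    rfl
  simp [this]

/-- Elements of `φₙ` may be projected from an almost direct summand onto a direct summand. -/
theorem mem_phi_of_add_mem {h : W →ₗ[BiRing R S T] U} (hh : Function.Injective h)
    {Z : Submodule (BiRing R S T) U} (hd : Disjoint Z (LinearMap.range h))
    (hg : Good K (Z ⊔ LinearMap.range h) ⊤) {z : U} (hz : z ∈ Z) {y : W}
    (hy : z + h y ∈ phi K e n U) : y ∈ phi K e n W := by
  obtain ⟨p, hp⟩ := exists_projection hh hd
  have hm : z + h y ∈ Z ⊔ LinearMap.range h := Submodule.add_mem_sup hz ⟨y, rfl⟩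
  have h1 : (⟨z + h y, hm⟩ : ↥(Z ⊔ LinearMap.range h)) ∈ phi K e n _ := by
    refine phi_of_good (Submodule.injective_subtype _) ?_ hy
    rwa [Submodule.range_subtype]
  have h2 := phi_map p h1
  rwa [hp z hz y hm] at h2

theorem right_mem_phi_of_add_mem {Z Y : Submodule (BiRing R S T) U} (hd : Disjoint Z Y)
    (hg : Good K (Z ⊔ Y) ⊤) {z y : U} (hz : z ∈ Z) (hy : y ∈ Y)
    (hzy : z + y ∈ phi K e n U) : y ∈ phi K e n U := by
  have hY : LinearMap.range Y.subtype = Y := Submodule.range_subtype Y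
  have : (⟨y, hy⟩ : Y) ∈ phi K e n Y :=
    mem_phi_of_add_mem (h := Y.subtype) (Submodule.injective_subtype _)
      (by rwa [hY]) (by rwa [hY]) hz hzy
  exact phi_map Y.subtype this

theorem left_mem_phi_of_add_mem {Z Y : Submodule (BiRing R S T) U} (hd : Disjoint Z Y)
    (hg : Good K (Z ⊔ Y) ⊤) {z y : U} (hz : z ∈ Z) (hy : y ∈ Y)
    (hzy : z + y ∈ phi K e n U) : z ∈ phi K e n U := by
  simpa using sub_mem_phi hzy (right_mem_phi_of_add_mem hd hg hz hy hzy)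

end

/-! ### Direct steps and summands at distinct levels -/

section

variable {C : Context R S T} {lam : Cardinal.{u}} {γ : Ordinal.{u} → Ordinal.{u}}
  {V : Bimod R S T} {M : Ordinal.{u} → Submodule (BiRing R S T) V}
  {I : Type u} {J : Ordinal.{u} → Set I} {N : I → Submodule (BiRing R S T) V} {α : Ordinal.{u}}

theorem DirectStep.indepOver (h : DirectStep C lam γ M J N α) : IndepOver (M α) N (J α) :=
  .of_subtype (.of_iSupIndep h.indep)

theorem DirectStep.isSumOfFew (h : DirectStep C lam γ M J N α) {t : I} (ht : t ∈ J α) :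
    IsSumOfFew C.K ℵ₀ (N t) := by
  obtain ⟨X, hX, ⟨φ⟩⟩ := h.iso_mem t ht
  exact .of_mem hX φ

theorem DirectStep.good (h : DirectStep C lam γ M J N α) {s : Finset I} (hs : ↑s ⊆ J α) :
    Good C.K (M α ⊔ s.sup N) (M (Order.succ α)) := by
  rw [h.succ_eq]
  exact h.indepOver.good (fun t ht => h.isSumOfFew ht) s hs

theorem DirectStep.good_self (h : DirectStep C lam γ M J N α) :
    Good C.K (M α) (M (Order.succ α)) := by
  simpa using h.good (s := ∅) (by simp)

theorem DirectStep.N_le (h : DirectStep C lam γ M J N α) {t : I} (ht : t ∈ J α) :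
    N t ≤ M (Order.succ α) := by
  rw [h.succ_eq]
  exact le_sup_of_le_right (le_biSup N ht)

end

namespace WeaklySemiNice

variable {C : Context R S T} {lam kap : Cardinal.{u}} {St : Set Ordinal.{u}}
  {γ : Ordinal.{u} → Ordinal.{u}}

theorem isSuccLimit_kap (A : WeaklySemiNice C lam kap St γ) : Order.IsSuccLimit kap.ord :=
  Cardinal.isSuccLimit_ord A.kap_regular.aleph0_le

theorem isSuccLimit_of_mem (A : WeaklySemiNice C lam kap St γ) {δ : Ordinal.{u}}
    (hδ : δ ∈ St) : Order.IsSuccLimit δ := by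
  have h := (A.St_sub δ hδ).2
  rcases Ordinal.zero_or_succ_or_isSuccLimit δ with rfl | ⟨a, rfl⟩ | h'
  · simp [Cardinal.aleph0_ne_zero.symm] at h
  · rw [Ordinal.cof_eq_one_iff.2 ⟨a, rfl⟩] at h
    exact absurd h Cardinal.one_lt_aleph0.ne
  · exact h'

theorem succ_notMem (A : WeaklySemiNice C lam kap St γ) (α : Ordinal.{u}) :
    Order.succ α ∉ St := fun h =>
  (Order.not_isSuccLimit_succ α) (A.isSuccLimit_of_mem h)

variable (A : WeaklySemiNice C lam kap St γ)

theorem M_le {α β : Ordinal.{u}} (h : α ≤ β) (hβ : β ≤ kap.ord) : A.M α ≤ A.M β := by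
  rcases h.eq_or_lt with rfl | h
  · exact le_rfl
  · exact A.M_mono α β h hβ

theorem exists_mem_M {δ : Ordinal.{u}} (hδ : δ ≤ kap.ord) (hl : Order.IsSuccLimit δ) {v : A.V}
    (hv : v ∈ A.M δ) : ∃ β < δ, v ∈ A.M β := by
  have : v ∈ (A.M δ : Set A.V) := hv
  rw [A.M_limit δ hδ hl] at this
  simpa using this

/-- All summands added at non-stationary stages from `β` on are independent over `M β`. -/
theorem indepOver_levels (β : Ordinal.{u}) :
    IndepOver (A.M β) A.N {t | ∃ a, β ≤ a ∧ a < kap.ord ∧ a ∉ St ∧ t ∈ A.J a} := by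
  classical
  intro s hs
  choose! lev hβ hk hSt hJ using fun t
    (ht : t ∈ {t | ∃ a, β ≤ a ∧ a < kap.ord ∧ a ∉ St ∧ t ∈ A.J a}) => ht
  induction s using Finset.induction_on_max_value lev with
  | empty => simp
  | insert t s hts hmax ih =>
    intro v hv hsum
    rw [Finset.coe_insert, Set.insert_subset_iff] at hs
    rw [Finset.sum_insert hts] at hsum
    set a := lev t
    have hstep := A.step a (hk t hs.1) (hSt t hs.1)
    have hle : A.M β ⊔ s.sup A.N ≤ A.M a ⊔ (s.filter fun x => lev x = a).sup A.N := by
      refine sup_le (le_sup_of_le_left (A.M_le (hβ t hs.1) (hk t hs.1).le))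
        (Finset.sup_le fun x hx => ?_)
      rcases (hmax x hx).eq_or_lt with h | h
      · exact le_sup_of_le_right (Finset.le_sup (f := A.N) (Finset.mem_filter.2 ⟨hx, h⟩))
      · have hx' := hs.2 hx
        refine le_sup_of_le_left (((A.step _ (hk x hx') (hSt x hx')).N_le (hJ x hx')).trans
          (A.M_le (Order.succ_le_of_lt h) (hk t hs.1).le))
    have hd : Disjoint (A.M a ⊔ (s.filter fun x => lev x = a).sup A.N) (A.N t) := by
      refine hstep.indepOver.disjoint_sup ?_ (hJ t hs.1) (fun h => hts (Finset.mem_filter.1 h).1)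
      intro x hx
      obtain ⟨hx, hxa⟩ := Finset.mem_filter.1 (Finset.mem_coe.1 hx)
      rw [← hxa]
      exact hJ x (hs.2 hx)
    have hsup : ∑ i ∈ s, v i ∈ s.sup A.N :=
      (mem_finset_sup_iff _ _).2 ⟨v, fun i hi => hv i (Finset.mem_insert_of_mem hi), rfl⟩
    have h0 : v t = 0 := by
      refine Submodule.disjoint_def.1 hd _ (hle ?_) (hv t (Finset.mem_insert_self _ _))
      have : v t = (v t + ∑ i ∈ s, v i) - ∑ i ∈ s, v i := by abel
      rw [this]
      exact Submodule.sub_mem _ (Submodule.mem_sup_left hsum) (Submodule.mem_sup_right hsup)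
    rw [h0, zero_add] at hsum
    intro i hi
    rcases Finset.mem_insert.1 hi with rfl | hi
    · exact h0
    · exact ih hs.2 v (fun i hi => hv i (Finset.mem_insert_of_mem hi)) hsum i hi

/-- If almost direct summands are known up to `δ`, then finitely many summands added between the
stages `β` and `β'` may be split off together with `M β`. -/
theorem good_levels {δ : Ordinal.{u}} (hδ : δ ≤ kap.ord)
    (H : ∀ a b, a ≤ b → b ≤ δ → a ∉ St → Good C.K (A.M a) (A.M b))
    {β : Ordinal.{u}} (hβSt : β ∉ St) (s : Finset A.I) (lev : A.I → Ordinal.{u})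
    (hlev : ∀ t ∈ s, β ≤ lev t ∧ lev t ∉ St ∧ t ∈ A.J (lev t)) {β' : Ordinal.{u}}
    (hlt : ∀ t ∈ s, lev t < β') (hββ' : β ≤ β') (hβ' : β' ≤ δ) :
    Good C.K (A.M β ⊔ s.sup A.N) (A.M β') := by
  classical
  induction s using Finset.strongInduction generalizing β' with
  | H s ih =>
    rcases s.eq_empty_or_nonempty with rfl | hne
    · simpa using H β β' hββ' hβ' hβSt
    · obtain ⟨t, hts, hmax⟩ := s.exists_max_image lev hne
      set a := lev t
      have haβ' : a < β' := hlt t hts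
      have hak : a < kap.ord := (haβ'.trans_le hβ').trans_le hδ
      have hstep := A.step a hak (hlev t hts).2.1
      have hlow := ih (s.filter fun x => lev x < a)
        (Finset.filter_ssubset.2 ⟨t, hts, lt_irrefl _⟩)
        (fun x hx => hlev x (Finset.mem_filter.1 hx).1) (β' := a)
        (fun x hx => (Finset.mem_filter.1 hx).2) (hlev t hts).1 (haβ'.le.trans hβ')
      have htop : ↑(s.filter fun x => ¬ lev x < a) ⊆ A.J a := by
        intro x hx
        obtain ⟨hx, hxa⟩ := Finset.mem_filter.1 (Finset.mem_coe.1 hx)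
        rw [← (hmax x hx).antisymm (not_lt.1 hxa)]
        exact (hlev x hx).2.2
      have h1 := hlow.sup_disjoint (hstep.indepOver.disjoint_finset_sup htop)
      rw [sup_assoc, ← Finset.sup_union, Finset.filter_union_filter_not_eq] at h1
      exact (h1.trans (hstep.good htop)).trans
        (H _ β' (Order.succ_le_of_lt haβ') hβ' (A.succ_notMem a))

end WeaklySemiNice

/-! ### Exchanging summands along a sequence of homomorphisms -/

section

variable {K : Set (Bimod R S T)} {V : Type u} [AddCommGroup V] [Module (BiRing R S T) V]

/-- Let `F n = u n + g n + F (n + 1) ∘ d n`, where the `g n` take values in `Z`.  If `Z`, the ranges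
of the `u n` for `m ≤ n < m + k` and the range of `F (m + k)` form a direct sum, then in this sum
the ranges of the `u n` can be exchanged for those of the `F n`, so that `Z ⊔ range (F m)` is
a direct summand with a complement in the class. -/
theorem good_exchange {X : ℕ → Bimod R S T} (hX : ∀ n, X n ∈ K)
    (d : ∀ n, X n →ₗ[BiRing R S T] X (n + 1)) {u g F : ∀ n, X n →ₗ[BiRing R S T] V}
    (hu : ∀ n, Function.Injective (u n)) (hF : ∀ n, Function.Injective (F n))
    (hrel : ∀ n, F n = u n + (g n + (F (n + 1)).comp (d n))) (k m : ℕ)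
    {Z : Submodule (BiRing R S T) V} (hg : ∀ n, LinearMap.range (g n) ≤ Z)
    (hI : IndepOver Z (fun n => LinearMap.range (u n)) (Set.Ico m (m + k)))
    (hd : Disjoint (Z ⊔ (Finset.Ico m (m + k)).sup fun n => LinearMap.range (u n))
      (LinearMap.range (F (m + k)))) :
    Disjoint Z (LinearMap.range (F m)) ∧ Good K (Z ⊔ LinearMap.range (F m))
      ((Z ⊔ (Finset.Ico m (m + k)).sup fun n => LinearMap.range (u n)) ⊔
        LinearMap.range (F (m + k))) := by
  induction k generalizing m Z with
  | zero => simpa using And.intro hd (Good.refl _)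
  | succ k ih =>
    have hIco : Finset.Ico m (m + (k + 1)) = insert m (Finset.Ico (m + 1) (m + 1 + k)) := by
      rw [Finset.insert_Ico_add_one_left_eq_Ico (by omega)]
      congr 1
      omega
    have hmk : m + (k + 1) = m + 1 + k := by omega
    rw [hIco, Finset.sup_insert, ← sup_assoc, hmk] at hd ⊢
    have hmem : m ∈ Set.Ico m (m + (k + 1)) := ⟨le_rfl, by omega⟩
    obtain ⟨h1, h2⟩ := ih (m + 1) (fun n => (hg n).trans le_sup_left)
      (hI.sup_of_insert hmem
        (fun n hn => ⟨by have := hn.1; omega, by have := hn.2; omega⟩)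
        (fun h => by have := h.1; omega)) hd
    have hZu : Disjoint Z (LinearMap.range (u m)) := hI.disjoint hmem
    have hZF : Disjoint Z (LinearMap.range (F (m + 1))) := h1.mono_left le_sup_left
    -- the summand `range (u m)` is replaced modulo `Z ⊔ range (F (m + 1))`
    have hdu : Disjoint (Z ⊔ LinearMap.range (F (m + 1))) (LinearMap.range (u m)) :=
      (hZu.symm.disjoint_sup_right_of_disjoint_sup_left (by rwa [sup_comm])).symm
    obtain ⟨h3, h4⟩ := disjoint_range_add (hu m) hdu
      (v := g m + (F (m + 1)).comp (d m)) (by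
        rintro _ ⟨y, rfl⟩
        exact Submodule.add_mem_sup (hg m ⟨y, rfl⟩) ⟨d m y, rfl⟩)
    rw [← hrel] at h3 h4
    refine ⟨h3.mono_left le_sup_left, Good.trans (M₂ := Z ⊔ LinearMap.range (u m) ⊔
      LinearMap.range (F (m + 1))) ?_ h2⟩
    have h5 : Disjoint (Z ⊔ LinearMap.range (F m)) (LinearMap.range (F (m + 1))) :=
      (hZF.symm.disjoint_sup_right_of_disjoint_sup_left (by rwa [sup_comm])).symm
    have h6 := Good.sup_right (K := K) (IsSumOfFew.range (hX (m + 1)) (hF (m + 1))) h5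
    rwa [sup_right_comm, h4, sup_right_comm] at h6

/-- The simultaneous version of `good_exchange` for finitely many sequences. -/
theorem good_exchange_family {J : Type*} {X : J → ℕ → Bimod R S T} (hX : ∀ s n, X s n ∈ K)
    (d : ∀ s n, X s n →ₗ[BiRing R S T] X s (n + 1)) {u g F : ∀ s n, X s n →ₗ[BiRing R S T] V}
    (hu : ∀ s n, Function.Injective (u s n)) (hF : ∀ s n, Function.Injective (F s n))
    (hrel : ∀ s n, F s n = u s n + (g s n + (F s (n + 1)).comp (d s n)))
    {W Y : Submodule (BiRing R S T) V} (hg : ∀ s n, LinearMap.range (g s n) ≤ W)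
    {m m' : J → ℕ} (hm : ∀ s, m s ≤ m' s) (D : Finset J)
    (hI : IndepOver W (fun x : J × ℕ => LinearMap.range (u x.1 x.2))
      {x | x.1 ∈ D ∧ x.2 ∈ Finset.Ico (m x.1) (m' x.1)})
    (hY : Good K (W ⊔ D.sup fun s => (Finset.Ico (m s) (m' s)).sup fun n =>
      LinearMap.range (u s n)) Y)
    (hH : IndepOver Y (fun s => LinearMap.range (F s (m' s))) ↑D) :
    Good K (W ⊔ D.sup fun s => LinearMap.range (F s (m s)))
      (Y ⊔ D.sup fun s => LinearMap.range (F s (m' s))) := by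
  classical
  set U : J → Submodule (BiRing R S T) V := fun s =>
    (Finset.Ico (m s) (m' s)).sup fun n => LinearMap.range (u s n) with hU
  set H : J → Submodule (BiRing R S T) V := fun s => LinearMap.range (F s (m' s)) with hHdef
  have hUY : ∀ s ∈ D, U s ≤ Y := fun s hs =>
    (le_sup_of_le_right (Finset.le_sup (f := U) hs)).trans hY.le
  have hWY : W ≤ Y := le_sup_left.trans hY.le
  have hIU : IndepOver W U D := hI.sigma (t := fun s => Finset.Ico (m s) (m' s))
    fun s hs n hn => ⟨hs, hn⟩
  have hUH : IndepOver W (fun s => U s ⊔ H s) D := hIU.sup_family hH hWY hUY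
  have key : ∀ D' : Finset J, D' ⊆ D → Good K (W ⊔ D'.sup fun s => LinearMap.range (F s (m s)))
      (W ⊔ D'.sup fun s => U s ⊔ H s) := by
    intro D'
    induction D' using Finset.induction_on with
    | empty => exact fun _ => by simpa using Good.refl W
    | insert s D' hs ih =>
      intro hD'
      obtain ⟨hsD, hD'⟩ := Finset.insert_subset_iff.1 hD'
      set B := W ⊔ D'.sup fun s => U s ⊔ H s with hB
      have hBd : Disjoint B (U s ⊔ H s) :=
        hUH.disjoint_sup (Finset.coe_subset.2 hD') (Finset.mem_coe.2 hsD) hs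
      have hUHs : Disjoint (U s) (H s) :=
        (hH.disjoint (Finset.mem_coe.2 hsD)).mono_left (hUY s hsD)
      obtain ⟨k, hk⟩ : ∃ k, m' s = m s + k := ⟨m' s - m s, by have := hm s; omega⟩
      have h1 : IndepOver B (fun n => LinearMap.range (u s n)) (Set.Ico (m s) (m s + k)) := by
        intro q hq v hv hsum
        have hq' : ∀ i ∈ q, i ∈ Finset.Ico (m s) (m' s) := fun i hi => by
          rw [hk, Finset.mem_Ico]
          exact hq hi
        have h0 : ∑ i ∈ q, v i = 0 := by
          refine Submodule.disjoint_def.1 hBd _ hsum (Submodule.mem_sup_left ?_)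
          exact Submodule.sum_mem _ fun i hi =>
            (Finset.le_sup (f := fun n => LinearMap.range (u s n)) (hq' i hi)) (hv i hi)
        have h2 : IndepOver W (fun n => LinearMap.range (u s n)) (Set.Ico (m s) (m s + k)) :=
          hI.comp (f := fun n : ℕ => (s, n)) (fun a _ b _ h => (Prod.ext_iff.1 h).2)
            fun n hn => ⟨hsD, by rw [hk, Finset.mem_Ico]; exact hn⟩
        exact h2 q hq v hv (by rw [h0]; exact W.zero_mem)
      have h2 : Disjoint (B ⊔ U s) (H s) :=
        hUHs.disjoint_sup_left_of_disjoint_sup_right hBd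
      obtain ⟨h3, h4⟩ := good_exchange (hX s) (d s) (hu s) (hF s) (hrel s) k (m s)
        (fun n => (hg s n).trans le_sup_left) h1 (by rw [← hk]; exact h2)
      rw [Finset.sup_insert, Finset.sup_insert, sup_comm (LinearMap.range _),
        sup_comm (U s ⊔ H s), ← sup_assoc, ← sup_assoc]
      have h5 : Good K (B ⊔ LinearMap.range (F s (m s))) (B ⊔ (U s ⊔ H s)) := by
        rw [← sup_assoc]
        rw [← hk] at h4
        exact h4
      exact ((ih hD').sup_disjoint h3).trans h5
  have h1 := key D le_rfl
  have h2 : (D.sup fun s => U s ⊔ H s) = D.sup U ⊔ D.sup H := Finset.sup_sup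
  rw [h2, ← sup_assoc] at h1
  exact h1.trans (hY.sup_disjoint (hH.disjoint_finset_sup le_rfl))

end

/-! ### The bimodules `P` -/

namespace ESystem

variable (e : ESystem R S T)

theorem trans_self (m : ℕ) (y : e.N m) : e.trans m le_rfl y = y := by
  simp [trans]

theorem trans_succ (m : ℕ) {n : ℕ} (h : m ≤ n) (y : e.N m) :
    e.trans m (Nat.le_succ_of_le h) y = e.g n (e.trans m h y) := by
  have h1 : e.trans m (Nat.le_succ_of_le h) = (e.g n).comp (e.trans m h) := Nat.leRec_succ _ _ h
  rw [h1]
  rfl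

theorem trans_g (m : ℕ) {n : ℕ} (h : m + 1 ≤ n) (y : e.N m) :
    e.trans (m + 1) h (e.g m y) = e.trans m (Nat.le_of_succ_le h) y := by
  induction n, h using Nat.le_induction with
  | base => rw [trans_self, trans_succ e m le_rfl, trans_self]
  | succ n hn ih =>
    rw [trans_succ e (m + 1) hn, ih, ← trans_succ]

/-- The homomorphism from `P` to `N n` which carries every summand `N m` with `m ≤ n` along the
sequence to `N n`, and annihilates the other summands. -/
noncomputable def collapse (n : ℕ) : e.P →ₗ[BiRing R S T] e.N n :=
  DirectSum.toModule (BiRing R S T) ℕ (e.N n) fun m => if h : m ≤ n then e.trans m h else 0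

theorem collapse_lof {m n : ℕ} (h : m ≤ n) (y : e.N m) :
    e.collapse n (DirectSum.lof (BiRing R S T) ℕ (fun n => e.N n) m y) = e.trans m h y := by
  rw [collapse, DirectSum.toModule_lof, dif_pos h]

theorem collapse_hP {m n : ℕ} (h : m + 1 ≤ n) (y : e.N m) : e.collapse n (e.hP m y) = 0 := by
  rw [hP, LinearMap.sub_apply, LinearMap.comp_apply, map_sub,
    collapse_lof e (Nat.le_of_succ_le h), collapse_lof e h, trans_g, sub_self]

/-- An element of `N m` which lies in the sum of the ranges of the `hP n` dies in the direct
limit of the sequence. -/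
theorem exists_trans_eq_zero {m : ℕ} {y : e.N m}
    (h : DirectSum.lof (BiRing R S T) ℕ (fun n => e.N n) m y ∈ ⨆ n, LinearMap.range (e.hP n)) :
    ∃ k, ∃ hk : m < k, e.trans m hk.le y = 0 := by
  have key : ∀ p ∈ ⨆ n, LinearMap.range (e.hP n), ∃ k, ∀ n ≥ k, e.collapse n p = 0 := by
    intro p hp
    induction hp using Submodule.iSup_induction' with
    | mem i x hx =>
      obtain ⟨y, rfl⟩ := hx
      exact ⟨i + 1, fun n hn => e.collapse_hP hn y⟩
    | zero => exact ⟨0, fun n _ => map_zero _⟩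
    | add x y _ _ hx hy =>
      obtain ⟨k, hk⟩ := hx
      obtain ⟨l, hl⟩ := hy
      refine ⟨max k l, fun n hn => ?_⟩
      rw [map_add, hk n ((le_max_left _ _).trans hn), hl n ((le_max_right _ _).trans hn), add_zero]
  obtain ⟨k, hk⟩ := key _ h
  refine ⟨max k (m + 1), lt_of_lt_of_le (Nat.lt_succ_self m) (le_max_right _ _), ?_⟩
  rw [← collapse_lof]
  exact hk _ (le_max_left _ _)

end ESystem

/-! ### Glueing steps -/

section

variable {C : Context R S T} {lam kap : Cardinal.{u}} {St : Set Ordinal.{u}}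
  {γ : Ordinal.{u} → Ordinal.{u}} {enumE : Ordinal.{u} → ESystem R S T}
  {V : Bimod R S T} {M : Ordinal.{u} → Submodule (BiRing R S T) V}
  {I : Type u} {J : Ordinal.{u} → Set I} {N : I → Submodule (BiRing R S T) V} {δ : Ordinal.{u}}

namespace GlueStep

variable (G : GlueStep C enumE kap St M J N δ)

/-- The embedding of the `n`-th summand of the copy `P s` of `P` into `V`. -/
noncomputable def F (s : J δ) (n : ℕ) : (G.e s).N n →ₗ[BiRing R S T] V :=
  (G.h s).comp (DirectSum.lof (BiRing R S T) ℕ (fun n => (G.e s).N n) n)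

/-- The isomorphism of `N n` onto the summand with index `t s n`, as a homomorphism into `V`. -/
noncomputable def u (s : J δ) (n : ℕ) : (G.e s).N n →ₗ[BiRing R S T] V :=
  (N (G.t s n)).subtype.comp (G.iso s n).toLinearMap

theorem range_u (s : J δ) (n : ℕ) : LinearMap.range (G.u s n) = N (G.t s n) := by
  rw [u, LinearMap.range_comp, LinearEquiv.range, Submodule.map_top, Submodule.range_subtype]

theorem u_injective (s : J δ) (n : ℕ) : Function.Injective (G.u s n) :=
  (Submodule.injective_subtype _).comp (G.iso s n).injective

theorem F_injective (s : J δ) (n : ℕ) : Function.Injective (G.F s n) :=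
  (G.h_injective s).comp (DirectSum.of_injective n)

theorem F_eq (s : J δ) (n : ℕ) :
    G.F s n = G.u s n + (G.g s n + (G.F s (n + 1)).comp ((G.e s).g n)) := by
  have h := G.h_comp s n
  rw [ESystem.hP, LinearMap.comp_sub, sub_eq_iff_eq_add] at h
  rw [← add_assoc]
  exact h

theorem F_apply (s : J δ) (n : ℕ) (y : (G.e s).N n) :
    G.F s n y = G.u s n y + (G.g s n y + G.F s (n + 1) ((G.e s).g n y)) := by
  conv_lhs => rw [G.F_eq s n]
  rfl

theorem range_F_le (s : J δ) (n : ℕ) : LinearMap.range (G.F s n) ≤ G.P s := by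
  rw [← G.h_range s]
  exact LinearMap.range_comp_le_range _ _

theorem P_le (s : J δ) : G.P s ≤ ⨆ n, LinearMap.range (G.F s n) := by
  rw [← G.h_range s]
  rintro _ ⟨p, rfl⟩
  induction p using DirectSum.induction_on with
  | zero => rw [map_zero]; exact Submodule.zero_mem _
  | of n y => exact Submodule.mem_iSup_of_mem n ⟨y, rfl⟩
  | add p q hp hq => rw [map_add]; exact Submodule.add_mem _ hp hq

/-- The `F s m y` expressed by the later terms of the sequence. -/
theorem F_sub_mem (s : J δ) (m : ℕ) {n : ℕ} (h : m ≤ n) (y : (G.e s).N m) :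
    ∃ v : ℕ → V, (∀ k (hk : m ≤ k), v k = G.u s k ((G.e s).trans m hk y)) ∧
      G.F s m y - ∑ k ∈ Finset.Ico m n, v k - G.F s n ((G.e s).trans m h y) ∈ M G.bound := by
  refine ⟨fun k => if hk : m ≤ k then G.u s k ((G.e s).trans m hk y) else 0,
    fun k hk => dif_pos hk, ?_⟩
  induction n, h using Nat.le_induction with
  | base => simp [ESystem.trans_self]
  | succ n hn ih =>
    rw [Finset.sum_Ico_succ_top hn, dif_pos hn, ESystem.trans_succ _ m hn]
    rw [G.F_apply s n] at ih
    have := Submodule.add_mem _ ih (G.g_range s n ⟨(G.e s).trans m hn y, rfl⟩)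
    convert this using 1
    abel

/-- If a finite sum of elements of the `F s (m s)` lies in `M δ`, then every term dies in the
direct limit of its sequence. -/
theorem exists_trans_eq_zero {D : Finset (J δ)} {m : J δ → ℕ} {y : ∀ s, (G.e s).N (m s)}
    (h : ∑ s ∈ D, G.F s (m s) (y s) ∈ M δ) {s : J δ} (hs : s ∈ D) :
    ∃ k, ∃ hk : m s < k, (G.e s).trans (m s) hk.le (y s) = 0 := by
  classical
  refine (G.e s).exists_trans_eq_zero ?_
  have h1 : G.F s (m s) (y s) ∈ M δ ⊔ ⨆ s', ⨆ _ : s' ≠ s, G.P s' := by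
    rw [← Finset.add_sum_erase _ _ hs] at h
    have h2 : ∑ s' ∈ D.erase s, G.F s' (m s') (y s') ∈ ⨆ s', ⨆ _ : s' ≠ s, G.P s' := by
      refine Submodule.sum_mem _ fun s' hs' => ?_
      exact Submodule.mem_iSup_of_mem s' (Submodule.mem_iSup_of_mem (Finset.ne_of_mem_erase hs')
        (G.range_F_le s' _ ⟨_, rfl⟩))
    have h3 := Submodule.sub_mem _ (Submodule.mem_sup_left h) (Submodule.mem_sup_right h2)
    rwa [add_sub_cancel_right] at h3
  have h4 : G.F s (m s) (y s) ∈ ⨆ n, LinearMap.range ((G.h s).comp ((G.e s).hP n)) := by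
    rw [← G.amalgam s]
    exact ⟨G.range_F_le s _ ⟨_, rfl⟩, h1⟩
  simp_rw [LinearMap.range_comp] at h4
  rw [← Submodule.map_iSup] at h4
  obtain ⟨p, hp, hps⟩ := h4
  rwa [G.h_injective s hps] at hp

end GlueStep

end

variable {C : Context R S T} {lam kap : Cardinal.{u}} {St : Set Ordinal.{u}}
  {γ : Ordinal.{u} → Ordinal.{u}}

theorem WeaklySemiNice.level_unique (A : WeaklySemiNice C lam kap St γ) {t : A.I}
    {a b : Ordinal.{u}} (ha : a < kap.ord) (hb : b < kap.ord) (hta : t ∈ A.J a)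
    (htb : t ∈ A.J b) : a = b := by
  rcases lt_trichotomy a b with h | h | h
  · exact absurd htb (Set.disjoint_right.1 (A.J_disjoint b a h hb) hta)
  · exact h
  · exact absurd hta (Set.disjoint_right.1 (A.J_disjoint a b h ha) htb)

namespace GlueStep

variable {A : WeaklySemiNice C lam kap St γ} {δ : Ordinal.{u}}
  (G : GlueStep C A.enumE kap St A.M A.J A.N δ)

theorem N_mem_K (s : A.J δ) (n : ℕ) : (G.e s).N n ∈ C.K := by
  obtain ⟨β, -, hβ, he⟩ := G.e_mem s
  exact C.N_mem _ (he ▸ A.enumE_bij.mapsTo hβ) n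

theorem a_lt (s : A.J δ) (n : ℕ) : G.a s n < δ :=
  (G.a_strictMono s (Nat.lt_succ_self n)).trans_le ((G.a_lub s).1 ⟨n + 1, rfl⟩)

/-- The stage from which on the summands attached to `s` have not been used before the stage
`β`. -/
noncomputable def level (β : Ordinal.{u}) (s : A.J δ) : ℕ := sInf {n | β ≤ G.a s n}

theorem a_lt_of_lt_level {β : Ordinal.{u}} {s : A.J δ} {n : ℕ} (h : n < G.level β s) :
    G.a s n < β :=
  not_le.1 (Nat.notMem_of_lt_sInf h)

theorem le_a_of_level_le {β : Ordinal.{u}} (hβ : β < δ) {s : A.J δ} {n : ℕ}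
    (h : G.level β s ≤ n) : β ≤ G.a s n := by
  have hne : {n | β ≤ G.a s n}.Nonempty := by
    obtain ⟨_, ⟨n, rfl⟩, hn⟩ := (lt_isLUB_iff (G.a_lub s)).1 hβ
    exact ⟨n, hn.le⟩
  exact (Nat.sInf_mem hne : β ≤ G.a s (G.level β s)).trans ((G.a_strictMono s).monotone h)

theorem level_mono {β β' : Ordinal.{u}} (h : β ≤ β') (hβ' : β' < δ) (s : A.J δ) :
    G.level β s ≤ G.level β' s :=
  not_lt.1 fun hlt => absurd (G.a_lt_of_lt_level hlt)
    (not_lt.2 (h.trans (G.le_a_of_level_le hβ' le_rfl)))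

/-- The branches of the members of `D` use disjoint sets of indices from the stage `β` on. -/
def Separated (β : Ordinal.{u}) (D : Finset (A.J δ)) : Prop :=
  ∀ s ∈ D, ∀ s' ∈ D, s ≠ s' → ∀ n n', β ≤ G.a s n → β ≤ G.a s' n' → G.t s n ≠ G.t s' n'

variable {G}

theorem Separated.mono {β β' : Ordinal.{u}} {D D' : Finset (A.J δ)} (h : G.Separated β D)
    (hβ : β ≤ β') (hD : D' ⊆ D) : G.Separated β' D' :=
  fun s hs s' hs' hne n n' hn hn' =>
    h s (hD hs) s' (hD hs') hne n n' (hβ.trans hn) (hβ.trans hn')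

variable (G)

theorem indepOver_t (hδ : δ < kap.ord) {β : Ordinal.{u}} {D : Finset (A.J δ)}
    (hD : G.Separated β D) :
    IndepOver (A.M β) (fun x : A.J δ × ℕ => A.N (G.t x.1 x.2))
      {x | x.1 ∈ D ∧ β ≤ G.a x.1 x.2} := by
  refine (A.indepOver_levels β).comp ?_ ?_
  · rintro ⟨s, n⟩ ⟨hs, hn⟩ ⟨s', n'⟩ ⟨hs', hn'⟩ h
    by_cases hss : s = s'
    · subst hss
      have h2 := G.t_mem s n'
      change G.t s n = G.t s n' at h
      rw [← h] at h2
      have := A.level_unique ((G.a_lt s n).trans hδ) ((G.a_lt s n').trans hδ) (G.t_mem s n) h2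
      rw [(G.a_strictMono s).injective this]
    · exact absurd h (hD s hs s' hs' hss n n' hn hn')
  · rintro ⟨s, n⟩ ⟨hs, hn⟩
    exact ⟨G.a s n, hn, (G.a_lt s n).trans hδ, G.a_not_mem s n, G.t_mem s n⟩

theorem indepOver_F (hδ : δ < kap.ord) {β : Ordinal.{u}} (hb : G.bound < β) (hβ : β < δ)
    {D : Finset (A.J δ)} (hD : G.Separated β D) :
    IndepOver (A.M β) (fun s => LinearMap.range (G.F s (G.level β s))) ↑D := by
  classical
  intro q hq v hv hsum
  have hy : ∀ s, ∃ y, s ∈ q → G.F s (G.level β s) y = v s := by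
    intro s
    by_cases hs : s ∈ q
    · obtain ⟨y, hy⟩ := hv s hs
      exact ⟨y, fun _ => hy⟩
    · exact ⟨0, fun h => absurd h hs⟩
  choose y hy using hy
  rw [← Finset.sum_congr rfl hy] at hsum
  have hk : ∀ s, ∃ k, s ∈ q → ∃ hk : G.level β s < k,
      (G.e s).trans (G.level β s) hk.le (y s) = 0 := by
    intro s
    by_cases hs : s ∈ q
    · obtain ⟨k, hk⟩ := G.exists_trans_eq_zero (A.M_le hβ.le hδ.le hsum) hs
      exact ⟨k, fun _ => hk⟩
    · exact ⟨0, fun h => absurd h hs⟩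
  choose k hk using hk
  have hw : ∀ s, ∃ w : ℕ → A.V, s ∈ q →
      (∀ n (hn : G.level β s ≤ n), w n = G.u s n ((G.e s).trans _ hn (y s))) ∧
      G.F s (G.level β s) (y s) - ∑ n ∈ Finset.Ico (G.level β s) (k s), w n ∈ A.M β := by
    intro s
    by_cases hs : s ∈ q
    · obtain ⟨hlt, h0⟩ := hk s hs
      obtain ⟨w, hw, hm⟩ := G.F_sub_mem s (G.level β s) hlt.le (y s)
      rw [h0, map_zero, sub_zero] at hm
      exact ⟨w, fun _ => ⟨hw, A.M_le hb.le (hβ.trans hδ).le hm⟩⟩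
    · exact ⟨0, fun h => absurd h hs⟩
  choose w hw using hw
  have hwN : ∀ s ∈ q, ∀ n ∈ Finset.Ico (G.level β s) (k s), w s n ∈ A.N (G.t s n) := by
    intro s hs n hn
    rw [(hw s hs).1 n (Finset.mem_Ico.1 hn).1, ← G.range_u s n]
    exact ⟨_, rfl⟩
  have hwsum : ∑ s ∈ q, ∑ n ∈ Finset.Ico (G.level β s) (k s), w s n ∈ A.M β := by
    have h1 := (A.M β).sum_mem fun s hs => (hw s hs).2
    rw [Finset.sum_sub_distrib] at h1
    simpa using Submodule.sub_mem _ hsum h1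
  have hI := G.indepOver_t hδ hD
  have hlev : ∀ s, ∀ n ∈ Finset.Ico (G.level β s) (k s), β ≤ G.a s n := fun s n hn =>
    G.le_a_of_level_le hβ (Finset.mem_Ico.1 hn).1
  have h1 := (hI.sigma (E := ↑D) (t := fun s => Finset.Ico (G.level β s) (k s))
    fun s hs n hn => ⟨hs, hlev s n hn⟩) q hq
    (fun s => ∑ n ∈ Finset.Ico (G.level β s) (k s), w s n)
    (fun s hs => (mem_finset_sup_iff _ _).2 ⟨w s, hwN s hs, rfl⟩) hwsum
  intro s hs
  obtain ⟨hlt, -⟩ := hk s hs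
  have h2 : IndepOver (A.M β) (fun n => A.N (G.t s n)) {n | β ≤ G.a s n} :=
    hI.comp (f := fun n : ℕ => (s, n)) (fun a _ b _ h => (Prod.ext_iff.1 h).2)
      fun n hn => ⟨hq hs, hn⟩
  have h3 := h2 (Finset.Ico (G.level β s) (k s)) (fun n hn => hlev s n hn) (w s) (hwN s hs)
    (by rw [h1 s hs]; exact Submodule.zero_mem _) (G.level β s)
    (Finset.mem_Ico.2 ⟨le_rfl, hlt⟩)
  rw [(hw s hs).1 _ le_rfl, ESystem.trans_self] at h3
  rw [← hy s hs, (map_eq_zero_iff _ (G.u_injective s _)).1 h3, map_zero]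

/-- The part of `M (δ + 1)` generated by `M β` and, for finitely many `s`, those summands of `P s`
which come after the summands amalgamated into `M β`. -/
noncomputable def stage (β : Ordinal.{u}) (D : Finset (A.J δ)) : Submodule (BiRing R S T) A.V :=
  A.M β ⊔ D.sup fun s => LinearMap.range (G.F s (G.level β s))

theorem stage_le (hδ : δ < kap.ord) {β : Ordinal.{u}} (hβ : β ≤ δ) (D : Finset (A.J δ)) :
    G.stage β D ≤ A.M (Order.succ δ) := by
  rw [G.succ_eq]
  refine sup_le_sup (A.M_le hβ hδ.le) (Finset.sup_le fun s _ => ?_)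
  exact (G.range_F_le s _).trans (le_iSup G.P s)

theorem stage_good (hδ : δ < kap.ord)
    (H : ∀ a b, a ≤ b → b ≤ δ → a ∉ St → Good C.K (A.M a) (A.M b))
    {β β' : Ordinal.{u}} (hb : G.bound < β) (hββ' : β ≤ β') (hβ' : β' < δ) (hβSt : β ∉ St)
    {D D' : Finset (A.J δ)} (hDD' : D ⊆ D') (hD : G.Separated β D) (hD' : G.Separated β' D') :
    Good C.K (G.stage β D) (G.stage β' D') := by
  classical
  have hI := G.indepOver_t hδ hD
  have hIco : ∀ s, ∀ n ∈ Finset.Ico (G.level β s) (G.level β' s), β ≤ G.a s n ∧ G.a s n < β' :=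
    fun s n hn => ⟨G.le_a_of_level_le (hββ'.trans_lt hβ') (Finset.mem_Ico.1 hn).1,
      G.a_lt_of_lt_level (Finset.mem_Ico.1 hn).2⟩
  have h1 : Good C.K (G.stage β D) (G.stage β' D) := by
    refine good_exchange_family (fun s n => G.N_mem_K s n) (fun s n => (G.e s).g n)
      G.u_injective G.F_injective G.F_eq (fun s n => (G.g_range s n).trans
        (A.M_le hb.le ((hββ'.trans hβ'.le).trans hδ.le)))
      (fun s => G.level_mono hββ' hβ' s) D ?_ ?_ ?_
    · simp_rw [G.range_u]
      exact hI.subset fun x hx => ⟨hx.1, (hIco x.1 x.2 hx.2).1⟩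
    · simp_rw [G.range_u]
      have h2 : (D.sup fun s => (Finset.Ico (G.level β s) (G.level β' s)).sup fun n =>
          A.N (G.t s n)) = (D.biUnion fun s =>
            (Finset.Ico (G.level β s) (G.level β' s)).image (G.t s)).sup A.N := by
        rw [Finset.sup_biUnion]
        simp_rw [Finset.sup_image]
        rfl
      rw [h2]
      have hex : ∀ t ∈ D.biUnion fun s =>
          (Finset.Ico (G.level β s) (G.level β' s)).image (G.t s),
          ∃ a, (β ≤ a ∧ a ∉ St ∧ t ∈ A.J a) ∧ a < β' := by
        intro t ht
        obtain ⟨s, hs, ht⟩ := Finset.mem_biUnion.1 ht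
        obtain ⟨n, hn, rfl⟩ := Finset.mem_image.1 ht
        exact ⟨G.a s n, ⟨(hIco s n hn).1, G.a_not_mem s n, G.t_mem s n⟩, (hIco s n hn).2⟩
      choose! lev hlev using hex
      exact A.good_levels hδ.le H hβSt _ lev (fun t ht => (hlev t ht).1)
        (fun t ht => (hlev t ht).2) hββ' hβ'.le
    · exact G.indepOver_F hδ (hb.trans_le hββ') hβ' (hD.mono hββ' le_rfl)
  refine h1.trans ?_
  exact (G.indepOver_F hδ (hb.trans_le hββ') hβ' hD').good_finset
    (fun s _ => IsSumOfFew.range (G.N_mem_K s _) (G.F_injective s _)) hDD' le_rfl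

theorem exists_separated (hδ : δ < kap.ord) {β : Ordinal.{u}} {D : Finset (A.J δ)}
    (hD : G.Separated β D) (s : A.J δ) :
    ∃ b < δ, ∀ β', β ≤ β' → b ≤ β' → ∀ D', (∀ x ∈ D', x = s ∨ x ∈ D) → G.Separated β' D' := by
  classical
  have hinj : Function.Injective (G.t s) := by
    intro n n' h
    have h2 := G.t_mem s n'
    rw [← h] at h2
    exact (G.a_strictMono s).injective
      (A.level_unique ((G.a_lt s n).trans hδ) ((G.a_lt s n').trans hδ) (G.t_mem s n) h2)
  have hfin : (⋃ s' ∈ D.erase s, G.t s ⁻¹' (Set.range (G.t s) ∩ Set.range (G.t s'))).Finite := by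
    refine Set.Finite.biUnion (Finset.finite_toSet _) fun s' hs' => ?_
    exact (G.tree_finite s s' (Finset.ne_of_mem_erase hs').symm).preimage hinj.injOn
  obtain ⟨k, hk⟩ := hfin.bddAbove
  have key : ∀ s' ∈ D, s ≠ s' → ∀ n n', G.a s (k + 1) ≤ G.a s n → G.t s n ≠ G.t s' n' := by
    intro s' hs' hne n n' hn h
    have h1 : n ≤ k := hk (Set.mem_biUnion (x := s')
      (Finset.mem_coe.2 (Finset.mem_erase.2 ⟨hne.symm, hs'⟩))
      ⟨⟨n, rfl⟩, ⟨n', h.symm⟩⟩)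
    have h2 := (G.a_strictMono s).le_iff_le.1 hn
    omega
  have hlev : ∀ s' n n', G.t s n = G.t s' n' → G.a s n = G.a s' n' := by
    intro s' n n' h
    refine A.level_unique ((G.a_lt s n).trans hδ) ((G.a_lt s' n').trans hδ) (G.t_mem s n) ?_
    rw [h]
    exact G.t_mem s' n'
  refine ⟨G.a s (k + 1), G.a_lt s _, fun β' hββ' hb D' hD' x hx x' hx' hne n n' hn hn' h => ?_⟩
  rcases hD' x hx with rfl | hxD
  · rcases hD' x' hx' with rfl | hxD'
    · exact hne rfl
    · exact key x' hxD' hne n n' (hb.trans hn) h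
  · rcases hD' x' hx' with rfl | hxD'
    · exact key x hxD hne.symm n' n (hb.trans hn') h.symm
    · exact hD x hxD x' hxD' hne n n' (hββ'.trans hn) (hββ'.trans hn') h

theorem mem_stage (hδ : δ < kap.ord) {β : Ordinal.{u}} (hb : G.bound < β) (hβ : β < δ)
    {D : Finset (A.J δ)} {s : A.J δ} (hs : s ∈ D) {n : ℕ} (hn : G.a s n < β)
    (y : (G.e s).N n) : G.F s n y ∈ G.stage β D := by
  have hle : n ≤ G.level β s := not_lt.1 fun h =>
    absurd hn (not_lt.2 (G.le_a_of_level_le hβ h.le))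
  obtain ⟨v, hv, hm⟩ := G.F_sub_mem s n hle y
  have h1 : G.F s (G.level β s) ((G.e s).trans n hle y) ∈ G.stage β D :=
    (le_sup_of_le_right (Finset.le_sup
      (f := fun s => LinearMap.range (G.F s (G.level β s))) hs)) ⟨_, rfl⟩
  have h2 : ∑ k ∈ Finset.Ico n (G.level β s), v k ∈ A.M β := by
    refine Submodule.sum_mem _ fun k hk => ?_
    obtain ⟨hk1, hk2⟩ := Finset.mem_Ico.1 hk
    have h3 : v k ∈ A.N (G.t s k) := by
      rw [hv k hk1, ← G.range_u s k]
      exact ⟨_, rfl⟩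
    have hlt := G.a_lt_of_lt_level hk2
    exact A.M_le (Order.succ_le_of_lt hlt) (hβ.trans hδ).le
      ((A.step _ (hlt.trans (hβ.trans hδ)) (G.a_not_mem s k)).N_le (G.t_mem s k) h3)
  have h4 := A.M_le hb.le (hβ.trans hδ).le hm
  have h5 := Submodule.add_mem _ (Submodule.add_mem _ (Submodule.mem_sup_left h4 :
    _ ∈ G.stage β D) h1) (Submodule.mem_sup_left h2 : _ ∈ G.stage β D)
  rwa [sub_add_cancel, sub_add_cancel] at h5

/-- If almost direct summands are known up to `δ`, then `M α` is an almost direct summand of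
`M (δ + 1)`. -/
theorem good_succ (G : GlueStep C A.enumE kap St A.M A.J A.N δ) (hδ : δ < kap.ord) (hl : Order.IsSuccLimit δ)
    (H : ∀ a b, a ≤ b → b ≤ δ → a ∉ St → Good C.K (A.M a) (A.M b)) {α : Ordinal.{u}}
    (hα : α < δ) (hαSt : α ∉ St) : Good C.K (A.M α) (A.M (Order.succ δ)) := by
  classical
  let Pos := {x : Ordinal.{u} × Finset (A.J δ) //
    G.bound < x.1 ∧ x.1 < δ ∧ x.1 ∉ St ∧ G.Separated x.1 x.2}
  let D : Pos → Submodule (BiRing R S T) A.V := fun x => G.stage x.1.1 x.1.2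
  have hgood : ∀ x y : Pos, x.1.1 ≤ y.1.1 → x.1.2 ⊆ y.1.2 → Good C.K (D x) (D y) :=
    fun x y h1 h2 => G.stage_good hδ H x.2.1 h1 y.2.2.1 x.2.2.2.1 h2 x.2.2.2.2 y.2.2.2.2
  -- every element of `M (δ + 1)` appears at arbitrarily late positions
  let U : Submodule (BiRing R S T) A.V :=
    { carrier := {v | ∀ x : Pos, ∃ y : Pos, x.1.1 ≤ y.1.1 ∧ x.1.2 ⊆ y.1.2 ∧ v ∈ D y}
      add_mem' := by
        intro v w hv hw x
        obtain ⟨y, h1, h2, hvy⟩ := hv x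
        obtain ⟨z, h3, h4, hwz⟩ := hw y
        exact ⟨z, h1.trans h3, h2.trans h4,
          Submodule.add_mem _ ((hgood y z h3 h4).le hvy) hwz⟩
      zero_mem' := fun x => ⟨x, le_rfl, le_rfl, Submodule.zero_mem _⟩
      smul_mem' := by
        intro r v hv x
        obtain ⟨y, h1, h2, hvy⟩ := hv x
        exact ⟨y, h1, h2, Submodule.smul_mem _ r hvy⟩ }
  have hU : A.M (Order.succ δ) ≤ U := by
    rw [G.succ_eq]
    refine sup_le ?_ (iSup_le fun s => (G.P_le s).trans (iSup_le fun n => ?_))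
    · rintro v hv ⟨⟨β, E⟩, hb, hβ, hβSt, hE⟩
      obtain ⟨b, hbδ, hvb⟩ := A.exists_mem_M hδ.le hl hv
      have hlt : Order.succ (max β b) < δ := hl.succ_lt (max_lt hβ hbδ)
      have hle : β ≤ Order.succ (max β b) := (le_max_left _ _).trans (Order.le_succ _)
      refine ⟨⟨(Order.succ (max β b), E), hb.trans_le hle, hlt, A.succ_notMem _,
        hE.mono hle le_rfl⟩, hle, le_rfl, Submodule.mem_sup_left ?_⟩
      exact A.M_le ((le_max_right _ _).trans (Order.le_succ _)) (hlt.trans hδ).le hvb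
    · rintro _ ⟨y, rfl⟩ ⟨⟨β, E⟩, hb, hβ, hβSt, hE⟩
      obtain ⟨b, hbδ, hsep⟩ := G.exists_separated hδ hE s
      set β' := Order.succ (max β (max b (G.a s n))) with hβ'def
      have hlt : β' < δ := hl.succ_lt (max_lt hβ (max_lt hbδ (G.a_lt s n)))
      have hle : β ≤ β' := (le_max_left _ _).trans (Order.le_succ _)
      have hle2 : b ≤ β' := ((le_max_left _ _).trans (le_max_right _ _)).trans (Order.le_succ _)
      have hle3 : G.a s n < β' :=
        Order.lt_succ_of_le ((le_max_right _ _).trans (le_max_right _ _))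
      refine ⟨⟨(β', insert s E), hb.trans_le hle, hlt, A.succ_notMem _,
        hsep β' hle hle2 _ fun x hx => Finset.mem_insert.1 hx⟩, hle,
        Finset.subset_insert _ _, ?_⟩
      exact G.mem_stage hδ (hb.trans_le hle) hlt (Finset.mem_insert_self _ _) hle3 y
  have hlt : Order.succ (max α G.bound) < δ := hl.succ_lt (max_lt hα G.bound_lt)
  let x₀ : Pos := ⟨(Order.succ (max α G.bound), ∅),
    Order.lt_succ_of_le (le_max_right _ _), hlt, A.succ_notMem _, by simp [Separated]⟩
  have h1 : Good C.K (D x₀) (A.M (Order.succ δ)) := by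
    refine Good.of_family D (fun x => G.stage_le hδ x.2.2.1.le _) (fun x v hv => ?_) x₀
    obtain ⟨y, h1, h2, h3⟩ := hU hv x
    exact ⟨y, h3, hgood x y h1 h2⟩
  have h2 : D x₀ = A.M (Order.succ (max α G.bound)) := by simp [D, x₀, stage]
  rw [h2] at h1
  exact (H α _ ((le_max_left _ _).trans (Order.le_succ _)) hlt.le hαSt).trans h1

end GlueStep

/-! ### Stages of the construction are almost direct summands -/

/-- Outside `St`, every stage is an almost direct summand of all later stages.  The proof is by
induction on `β`; the successors of members of `St` are where the glueing analysis enters. -/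
theorem WeaklySemiNice.good (A : WeaklySemiNice C lam kap St γ) {α β : Ordinal.{u}}
    (h : α ≤ β) (hβ : β ≤ kap.ord) (hα : α ∉ St) : Good C.K (A.M α) (A.M β) := by
  induction β using WellFoundedLT.induction generalizing α with
  | ind β ih =>
    rcases h.eq_or_lt with rfl | hlt
    · exact .refl _
    rcases Ordinal.zero_or_succ_or_isSuccLimit β with rfl | ⟨b, rfl⟩ | hl
    · exact absurd hlt not_lt_zero
    · have hb : b < kap.ord := (Order.lt_succ b).trans_le hβ
      have hαb : α ≤ b := Order.lt_succ_iff.1 hlt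
      have hdirect : ∀ _ : DirectStep C lam γ A.M A.J A.N b,
          Good C.K (A.M α) (A.M (Order.succ b)) := fun hd =>
        (ih b (Order.lt_succ b) hαb hb.le hα).trans hd.good_self
      by_cases hbSt : b ∈ St
      · rcases A.step_St b hbSt with hd | ⟨⟨G⟩⟩
        · exact hdirect hd
        · have hne : α ≠ b := fun h => hα (h ▸ hbSt)
          exact G.good_succ hb (A.isSuccLimit_of_mem hbSt)
            (fun a c hac hc haSt => ih c (hc.trans_lt (Order.lt_succ b)) hac (hc.trans hb.le) haSt)
            (lt_of_le_of_ne hαb hne) hα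
      · exact hdirect (A.step b hb hbSt)
    · refine Good.of_family (fun x : {x : Ordinal.{u} // x < β ∧ x ∉ St} => A.M x.1)
        (fun x => A.M_le x.2.1.le hβ) (fun x v hv => ?_) ⟨α, hlt, hα⟩
      obtain ⟨b, hb, hvb⟩ := A.exists_mem_M hβ hl hv
      have hs : Order.succ (max x.1 b) < β := hl.succ_lt (max_lt x.2.1 hb)
      refine ⟨⟨Order.succ (max x.1 b), hs, A.succ_notMem _⟩, ?_, ?_⟩
      · exact A.M_le ((le_max_right _ _).trans (Order.le_succ _)) (hs.le.trans hβ) hvb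
      · exact ih _ hs ((le_max_left _ _).trans (Order.le_succ _)) (hs.le.trans hβ) x.2.2

theorem WeaklySemiNice.good_top (A : WeaklySemiNice C lam kap St γ) {α : Ordinal.{u}}
    (h : α ≤ kap.ord) (hα : α ∉ St) : Good C.K (A.M α) ⊤ := by
  have := A.good h le_rfl hα
  rwa [A.M_kap] at this

variable {C : Context R S T} {lam kap : Cardinal.{u}} {St : Set Ordinal.{u}}
  {γ : Ordinal.{u} → Ordinal.{u}}

/-! ### Homomorphisms from the bimodules `N n` into the construction -/

theorem ESystem.genCard_spec (e : ESystem R S T) : ℵ₀ ≤ e.genCard ∧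
    ∀ n, ∃ A : Set (e.N n), #A < e.genCard ∧ Submodule.span (BiRing R S T) A = ⊤ := by
  refine csInf_mem (s := {c | ℵ₀ ≤ c ∧ ∀ n, ∃ A : Set (e.N n), #A < c ∧
    Submodule.span (BiRing R S T) A = ⊤}) ?_
  refine ⟨max ℵ₀ (Order.succ (⨆ n, #(e.N n))), le_max_left _ _, fun n =>
    ⟨Set.univ, ?_, Submodule.span_univ⟩⟩
  rw [Cardinal.mk_univ]
  exact (Order.lt_succ_of_le (le_ciSup Cardinal.bddAbove_of_small n)).trans_le (le_max_right _ _)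

theorem Context.genCard_le (C : Context R S T) {e : ESystem R S T} (he : e ∈ C.E) :
    e.genCard ≤ C.genCard := by
  have := C.small_E
  exact le_ciSup (f := fun e : C.E => e.1.genCard) Cardinal.bddAbove_of_small ⟨e, he⟩

namespace WeaklySemiNice

theorem exists_le_notMem (A : WeaklySemiNice C lam kap St γ) {β : Ordinal.{u}} (hβ : β < kap.ord) :
    ∃ β' < kap.ord, β' ∉ St ∧ β ≤ β' :=
  ⟨Order.succ β, A.isSuccLimit_kap.succ_lt hβ, A.succ_notMem β, Order.le_succ β⟩

variable (A : WeaklySemiNice C lam kap St γ) {e : ESystem R S T}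

theorem exists_mem (v : A.V) : ∃ β < kap.ord, v ∈ A.M β :=
  A.exists_mem_M le_rfl A.isSuccLimit_kap (by rw [A.M_kap]; trivial)

theorem exists_range_le (he : e ∈ C.E) (n : ℕ) (h : e.N n →ₗ[BiRing R S T] A.V) :
    ∃ β < kap.ord, LinearMap.range h ≤ A.M β := by
  obtain ⟨X, hX, hspan⟩ := e.genCard_spec.2 n
  choose b hb hbM using fun x : X => A.exists_mem (h x)
  have hlt : ⨆ x, b x < kap.ord := by
    refine Ordinal.iSup_lt_of_lt_cof ?_ hb
    rw [A.kap_regular.cof_ord]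
    exact (hX.trans_le (C.genCard_le he)).trans A.genCard_lt
  refine ⟨⨆ x, b x, hlt, ?_⟩
  rw [LinearMap.range_eq_map, ← hspan, Submodule.map_span, Submodule.span_le]
  rintro _ ⟨x, hx, rfl⟩
  exact A.M_le (Ordinal.le_iSup b ⟨x, hx⟩) hlt.le (hbM ⟨x, hx⟩)

/-- At a stage outside `St`, every member of the class has a copy which is a new direct summand. -/
theorem exists_embedding {β : Ordinal.{u}} (hβ : β < kap.ord) (hβSt : β ∉ St) {X : Bimod R S T}
    (hX : X ∈ C.K) : ∃ h : X →ₗ[BiRing R S T] A.V, Function.Injective h ∧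
      Disjoint (A.M β) (LinearMap.range h) ∧
      Good C.K (A.M β ⊔ LinearMap.range h) (A.M (Order.succ β)) := by
  have hstep := A.step β hβ hβSt
  have hne : #(A.M β) ≠ 0 := Cardinal.mk_ne_zero _
  have hne' := (pos_iff_ne_zero.2 hne).trans_le (hstep.many X hX)
  obtain ⟨⟨⟨t, ht⟩, ⟨φ⟩⟩⟩ := Cardinal.mk_ne_zero_iff.1 hne'.ne'
  have hr : LinearMap.range ((A.N t).subtype.comp φ.symm.toLinearMap) = A.N t := by
    rw [LinearMap.range_comp, LinearEquiv.range, Submodule.map_top, Submodule.range_subtype]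
  refine ⟨(A.N t).subtype.comp φ.symm.toLinearMap,
    (Submodule.injective_subtype _).comp φ.symm.injective, ?_, ?_⟩
  · rw [hr]
    exact hstep.indepOver.disjoint ht
  · rw [hr]
    have := hstep.good (s := {t}) (by simpa using ht)
    rwa [Finset.sup_singleton] at this

/-! ### From free homomorphisms to all homomorphisms -/

/-- The hypothesis on free homomorphisms, applied to `h + h₁`, where `h₁` is a new copy of
`N n`. -/
theorem PrMinus.add {α β : Ordinal.{u}} {n : ℕ} {A : WeaklySemiNice C lam kap St γ}
    {f : A.V →+ A.V} (hP : A.PrMinus f e α n) (he : e ∈ C.E)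
    (hα : α ∉ St) (hαβ : α ≤ β) (hβ : β < kap.ord)
    {h h₁ : e.N n →ₗ[BiRing R S T] A.V} (hh : LinearMap.range h ≤ A.M β)
    (hi : Function.Injective h₁) (hd : Disjoint (A.M β) (LinearMap.range h₁))
    (hg : Good C.K (A.M β ⊔ LinearMap.range h₁) (A.M (Order.succ β))) (l : ℕ) :
    ∃ a ∈ A.M α, ∃ b ∈ phi C.K e l A.V, ∃ c, f (h (e.x n)) + f (h₁ (e.x n)) =
      a + b + (h c + h₁ c) := by
  obtain ⟨hd', hs⟩ := disjoint_range_add hi hd hh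
  have hββ := A.isSuccLimit_kap.succ_lt hβ
  have hgood := (A.good hαβ hβ.le hα).sup_disjoint hd'
  rw [hs] at hgood
  obtain ⟨a, ha, b, hb, c, ⟨c, rfl⟩, habc⟩ := hP (Order.succ β) (Order.lt_succ_of_le hαβ) hββ
    (A.succ_notMem β) (h₁ + h)
    { le := A.M_le (hαβ.trans (Order.le_succ β)) hββ.le
      range_le := by
        refine le_trans ?_ hg.le
        rw [← hs]
        exact le_sup_right
      iso_mem := ⟨_, C.N_mem e he n, ⟨LinearEquiv.refl _ _⟩⟩
      disjoint := hd'.mono_left (A.M_le hαβ hβ.le)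
      almost := (hgood.trans hg).almostSummand } l
  refine ⟨a, ha, b, hb, c, ?_⟩
  rw [LinearMap.add_apply, map_add, LinearMap.add_apply] at habc
  rw [add_comm, habc, add_comm (h₁ c)]

/-- The element `z` is read off from one fixed copy of `N n` over `M α`; a further copy, free over
both that one and the range of a given `h`, shows that the same `z` serves `h`. -/
theorem PrMinus.exists_prOne {α : Ordinal.{u}} {n : ℕ} {A : WeaklySemiNice C lam kap St γ}
    {f : A.V →+ A.V} (hf : IsRLinear (R := R) (S := S) (T := T) f)
    (hP : A.PrMinus f e α n) (he : e ∈ C.E) (hακ : α < kap.ord) (hα : α ∉ St) :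
    ∃ z ∈ L C.K e n, A.PrOne f e α n z := by
  have hNK := C.N_mem e he n
  have hαs : Order.succ α < kap.ord := A.isSuccLimit_kap.succ_lt hακ
  obtain ⟨h₀, hi₀, hd₀, hg₀⟩ := A.exists_embedding hακ hα hNK
  have hg₀' : Good C.K (A.M α ⊔ LinearMap.range h₀) ⊤ :=
    hg₀.trans (A.good_top hαs.le (A.succ_notMem α))
  -- the game for `M α ⊔ range h₀` yields the decomposition of `f (h₀ x)` which defines `z`
  obtain ⟨P, -, hPd, hPv, hPg⟩ := hg₀'.exists_extension (v := f (h₀ (e.x n))) trivial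
  obtain ⟨w, hw, k, hk, hwk⟩ := Submodule.mem_sup.1 hPv
  obtain ⟨a₀, ha₀, _, ⟨z, rfl⟩, rfl⟩ := Submodule.mem_sup.1 hw
  have hdZ : Disjoint (A.M α ⊔ P) (LinearMap.range h₀) := by
    rw [sup_comm] at hPd
    have := hd₀.symm.disjoint_sup_right_of_disjoint_sup_left hPd
    exact this.symm
  have hgZ : Good C.K (A.M α ⊔ P ⊔ LinearMap.range h₀) ⊤ := by rwa [sup_right_comm]
  have hz : ∀ l, ∀ a ∈ A.M α, ∀ b ∈ phi C.K e l A.V, ∀ z',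
      f (h₀ (e.x n)) = a + b + h₀ z' → z - z' ∈ phi C.K e l (e.N n) := by
    intro l a ha b hb z' h
    refine mem_phi_of_add_mem hi₀ hdZ hgZ
      (Submodule.add_mem_sup ((A.M α).sub_mem ha₀ ha) hk) ?_
    have : a₀ - a + k + h₀ (z - z') = b := by
      rw [← hwk] at h
      rw [map_sub]
      linear_combination (norm := abel) h
    rwa [this]
  -- all homomorphisms, up to `φ_l`
  have hall : ∀ (h : e.N n →ₗ[BiRing R S T] A.V) (l : ℕ), ∃ a ∈ A.M α, ∃ b ∈ phi C.K e l A.V,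
      f (h (e.x n)) - h z = a + b := by
    intro h l
    obtain ⟨β₁, hβ₁, hβh⟩ := A.exists_range_le he n h
    obtain ⟨β₂, hβ₂, hβfh⟩ := A.exists_mem (f (h (e.x n)))
    obtain ⟨β₃, hβ₃, hβfh₀⟩ := A.exists_mem (f (h₀ (e.x n)))
    obtain ⟨β, hβ, hβSt, hle⟩ := A.exists_le_notMem (β := max (max β₁ β₂) (max β₃ (Order.succ α)))
      (max_lt (max_lt hβ₁ hβ₂) (max_lt hβ₃ hαs))
    simp only [max_le_iff] at hle
    have hαβ : α ≤ β := (Order.le_succ α).trans hle.2.2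
    obtain ⟨h₁, hi₁, hd₁, hg₁⟩ := A.exists_embedding hβ hβSt hNK
    have hg₁' : Good C.K (A.M β ⊔ LinearMap.range h₁) ⊤ :=
      hg₁.trans (A.good_top (A.isSuccLimit_kap.succ_lt hβ).le (A.succ_notMem β))
    obtain ⟨a, ha, b, hb, z₁, hz₁⟩ := hP.add he hα hαβ hβ (h := 0) (by
      rw [LinearMap.range_zero]; exact bot_le) hi₁ hd₁ hg₁ l
    simp only [LinearMap.zero_apply, map_zero, zero_add] at hz₁
    have key : ∀ h' : e.N n →ₗ[BiRing R S T] A.V, LinearMap.range h' ≤ A.M β →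
        f (h' (e.x n)) ∈ A.M β → ∃ a ∈ A.M α, ∃ b ∈ phi C.K e l A.V,
        f (h' (e.x n)) = a + b + h' z₁ := by
      intro h' hh' hfh'
      obtain ⟨a', ha', b', hb', z₂, hz₂⟩ := hP.add he hα hαβ hβ hh' hi₁ hd₁ hg₁ l
      have h12 : z₁ - z₂ ∈ phi C.K e l (e.N n) := by
        refine mem_phi_of_add_mem hi₁ hd₁ hg₁' (z := f (h' (e.x n)) - (a' - a) - h' z₂) ?_ ?_
        · exact Submodule.sub_mem _ (Submodule.sub_mem _ hfh'
            (A.M_le hαβ hβ.le ((A.M α).sub_mem ha' ha))) (hh' ⟨z₂, rfl⟩)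
        · have : f (h' (e.x n)) - (a' - a) - h' z₂ + h₁ (z₁ - z₂) = b' - b := by
            rw [map_sub]
            linear_combination (norm := abel) hz₂ - hz₁
          rw [this]
          exact sub_mem_phi hb' hb
      refine ⟨a' - a, (A.M α).sub_mem ha' ha, b' - b - h' (z₁ - z₂) - h₁ (z₁ - z₂),
        sub_mem_phi (sub_mem_phi (sub_mem_phi hb' hb) (phi_map h' h12)) (phi_map h₁ h12), ?_⟩
      rw [map_sub, map_sub]
      linear_combination (norm := abel) hz₂ - hz₁
    obtain ⟨a₁, ha₁, b₁, hb₁, h1⟩ := key h₀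
      ((le_sup_right.trans hg₀.le).trans (A.M_le hle.2.2 hβ.le)) (A.M_le hle.2.1 hβ.le hβfh₀)
    have hzz := hz l a₁ ha₁ b₁ hb₁ z₁ h1
    obtain ⟨a₂, ha₂, b₂, hb₂, h2⟩ := key h (hβh.trans (A.M_le hle.1.1 hβ.le))
      (A.M_le hle.1.2 hβ.le hβfh)
    refine ⟨a₂, ha₂, b₂ - h (z - z₁), sub_mem_phi hb₂ (phi_map h hzz), ?_⟩
    rw [map_sub]
    linear_combination (norm := abel) h2
  -- the game for `M α` makes the decomposition independent of `l`
  have hone : A.PrOne f e α n z := by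
    intro h
    obtain ⟨Q, -, hQd, hQv, hQg⟩ :=
      (A.good_top hακ.le hα).exists_extension (v := f (h (e.x n)) - h z) trivial
    obtain ⟨a, ha, q, hq, haq⟩ := Submodule.mem_sup.1 hQv
    refine ⟨a, ha, q, Set.mem_iInter.2 fun l => ?_, haq.symm⟩
    obtain ⟨a', ha', b', hb', h'⟩ := hall h l
    refine right_mem_phi_of_add_mem hQd hQg ((A.M α).sub_mem ha ha') hq ?_
    have : a - a' + q = b' := by linear_combination (norm := abel) haq + h'
    rwa [this]
  refine ⟨z, ⟨?_, ?_⟩, hone⟩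
  · obtain ⟨a, ha, b, hb, hab⟩ := hall h₀ n
    have hfx : f (h₀ (e.x n)) ∈ phi C.K e n A.V :=
      mem_phi_of_hom _ (hf.comp (IsRLinear.of_linearMap h₀))
    refine mem_phi_of_add_mem hi₀ hd₀ hg₀' ha ?_
    have : a + h₀ z = f (h₀ (e.x n)) - b := by linear_combination (norm := abel) -hab
    rw [this]
    exact sub_mem_phi hfx hb
  · intro W hW h₁ h₂ hx
    obtain ⟨j, hj, hjd, hjg⟩ := A.exists_embedding hακ hα hW
    obtain ⟨a₁, ha₁, b₁, hb₁, h1⟩ := hone (j.comp h₁)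
    obtain ⟨a₂, ha₂, b₂, hb₂, h2⟩ := hone (j.comp h₂)
    rw [LinearMap.comp_apply, LinearMap.comp_apply] at h1 h2
    rw [← hx] at h2
    refine Set.mem_iInter.2 fun l => ?_
    refine mem_phi_of_add_mem hj hjd (hjg.trans (A.good_top hαs.le (A.succ_notMem α)))
      ((A.M α).sub_mem ha₁ ha₂) ?_
    have : a₁ - a₂ + j (h₁ z - h₂ z) = b₂ - b₁ := by
      rw [map_sub]
      linear_combination (norm := abel) h2 - h1
    rw [this]
    exact sub_mem_phi (Set.mem_iInter.1 hb₂ l) (Set.mem_iInter.1 hb₁ l)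

end WeaklySemiNice

end

/-! ### Closure points outside `St` -/

theorem nat_iSup_lt_ord {c : Cardinal.{u}} (hc : c.IsRegular) (h0 : ℵ₀ < c)
    {f : ℕ → Ordinal.{u}} (hf : ∀ n, f n < c.ord) : ⨆ n, f n < c.ord := by
  refine Ordinal.lift_iSup_lt_of_lt_cof ?_ hf
  simpa [hc.cof_ord] using h0

theorem sSup_image_Iio_lt_ord {c : Cardinal.{u}} (hc : c.IsRegular)
    {f : Ordinal.{u} → Ordinal.{u}} (hf : ∀ a < c.ord, f a < c.ord) {b : Ordinal.{u}}
    (hb : b < c.ord) : sSup (f '' Set.Iio b) < c.ord := by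
  refine Ordinal.sSup_lt_of_lt_cof ?_ ?_
  · refine Cardinal.mk_image_le.trans_lt ?_
    rw [Cardinal.mk_Iio_ordinal, ← Ordinal.lift_cof, hc.cof_ord, Cardinal.lift_lt]
    exact Cardinal.lt_ord.1 hb
  · rintro _ ⟨a, ha, rfl⟩
    exact hf a (lt_trans ha hb)

/-- The points closed under a function form a club in an uncountable regular cardinal. -/
theorem isClub_closed_under {c : Cardinal.{u}} (hc : c.IsRegular) (h0 : ℵ₀ < c)
    {f : Ordinal.{u} → Ordinal.{u}} (hf : ∀ a < c.ord, f a < c.ord) :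
    IsClub {δ : Set.Iio c.ord | ∀ a < δ.1, f a < δ.1} := by
  refine ⟨?_, ?_⟩
  · intro d hd _ _ δ hδ a ha
    obtain ⟨x, hx, hax⟩ := (lt_isLUB_iff hδ).1
      (show (⟨a, lt_trans ha δ.2⟩ : Set.Iio c.ord) < δ from ha)
    exact (hd hx a hax).trans_le (hδ.1 hx)
  · rintro ⟨x, hx⟩
    have hl : Order.IsSuccLimit c.ord := Cardinal.isSuccLimit_ord hc.aleph0_le
    let g : Ordinal.{u} → Ordinal.{u} := fun b => Order.succ (max b (sSup (f '' Set.Iio b)))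
    have hg : ∀ b < c.ord, g b < c.ord := fun b hb =>
      hl.succ_lt (max_lt hb (sSup_image_Iio_lt_ord hc hf hb))
    have hfg : ∀ b, ∀ a < b, f a < g b := fun b a hab => by
      refine Order.lt_succ_of_le (le_max_of_le_right ?_)
      exact le_csSup Ordinal.bddAbove_of_small ⟨a, hab, rfl⟩
    let s : ℕ → Ordinal.{u} := fun n => g^[n] x
    have hsucc : ∀ n, s (n + 1) = g (s n) := fun n => Function.iterate_succ_apply' g n x
    have hs : ∀ n, s n < c.ord := by
      intro n
      induction n with
      | zero => exact hx
      | succ n ih => rw [hsucc]; exact hg _ ih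
    refine ⟨⟨⨆ n, s n, nat_iSup_lt_ord hc h0 hs⟩, ?_, Ordinal.le_iSup s 0⟩
    intro a ha
    obtain ⟨n, hn⟩ := Ordinal.lt_iSup_iff.1 ha
    calc f a < g (s n) := hfg _ _ hn
      _ = s (n + 1) := (hsucc n).symm
      _ ≤ ⨆ n, s n := Ordinal.le_iSup s _

section

variable {R S T : Type u} [Ring R] [Ring S] [CommRing T] [Algebra T R] [Algebra T S]

variable {C : Context R S T} {lam kap : Cardinal.{u}} {St : Set Ordinal.{u}}
  {γ : Ordinal.{u} → Ordinal.{u}}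

namespace WeaklySemiNice

variable {e : ESystem R S T}

theorem aleph0_lt_kap (A : WeaklySemiNice C lam kap St γ) (he : e ∈ C.E) : ℵ₀ < kap :=
  (e.genCard_spec.1.trans (C.genCard_le he)).trans_lt A.genCard_lt

/-- There is a closure point outside `St` which is the limit of a sequence of type `ω`. -/
theorem exists_closed (A : WeaklySemiNice C lam kap St γ) (h0 : ℵ₀ < kap) {B : Ordinal.{u} → Ordinal.{u}}
    (hB : ∀ a < kap.ord, B a < kap.ord) :
    ∃ δ < kap.ord, δ ∉ St ∧ Order.IsSuccLimit δ ∧ (∀ a < δ, B a < δ) ∧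
      ∃ d : ℕ → Ordinal.{u}, (∀ k, d k < δ) ∧ ∀ b < δ, ∃ k, b ≤ d k := by
  obtain ⟨⟨δ, hδ⟩, ⟨hcof, hSt⟩, hcl⟩ :=
    A.St_compl_stationary (isClub_closed_under A.kap_regular h0 hB)
  change δ.cof = ℵ₀ at hcof
  refine ⟨δ, hδ, hSt, ?_, hcl, ?_⟩
  · rw [← Ordinal.one_lt_cof_iff, hcof]
    exact Cardinal.one_lt_aleph0
  · obtain ⟨f, hf⟩ := Ordinal.exists_isFundamentalSeq (o := δ) (a := Ordinal.omega0)
      (by rw [hcof, Cardinal.ord_aleph0])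
    refine ⟨fun k => f ⟨k, Ordinal.natCast_lt_omega0 k⟩, fun k => (f _).2, fun b hb => ?_⟩
    obtain ⟨_, ⟨⟨c, hc⟩, rfl⟩, hbc⟩ := hf.isCofinal_range ⟨b, hb⟩
    obtain ⟨k, rfl⟩ := Ordinal.lt_omega0.1 hc
    exact ⟨k, hbc⟩

end WeaklySemiNice

/-! ### The key approximation argument -/

theorem ESystem.toModule_eq_sum (e : ESystem R S T) {V : Type u} [AddCommGroup V]
    [Module (BiRing R S T) V] (g : ∀ n, e.N n →ₗ[BiRing R S T] V) (w : e.P) :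
    ∃ m₀, ∀ m ≥ m₀, DirectSum.toModule (BiRing R S T) ℕ V g w =
      ∑ j ∈ Finset.range m, g j (w j) := by
  induction w using DirectSum.induction_on with
  | zero => exact ⟨0, fun m _ => by simp⟩
  | of i y =>
    refine ⟨i + 1, fun m hm => ?_⟩
    rw [Finset.sum_eq_single_of_mem i (Finset.mem_range.2 hm)]
    · rw [DirectSum.of_eq_same]
      exact DirectSum.toModule_lof _ _ _
    · intro j _ hj
      rw [DirectSum.of_eq_of_ne _ _ _ hj, map_zero]
  | add v w hv hw =>
    obtain ⟨m₁, h₁⟩ := hv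
    obtain ⟨m₂, h₂⟩ := hw
    refine ⟨max m₁ m₂, fun m hm => ?_⟩
    rw [map_add, h₁ m ((le_max_left _ _).trans hm), h₂ m ((le_max_right _ _).trans hm),
      ← Finset.sum_add_distrib]
    exact Finset.sum_congr rfl fun j _ => by rw [DirectSum.add_apply, map_add]

namespace WeaklySemiNice

variable {A : WeaklySemiNice C lam kap St γ} {e : ESystem R S T}

/-- If the sums `M α_j ⊕ range h_j` are almost direct summands in a chain, the contributions of the
later `h_j` can be removed from an element of `φ_l`. -/
theorem mem_phi_of_sub_sum_mem {al be : ℕ → Ordinal.{u}} (hbe : ∀ j, be j < kap.ord)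
    (hbeSt : ∀ j, be j ∉ St) (hle : ∀ j, be j ≤ al (j + 1)) (hmono : Monotone al)
    (hal : ∀ j, al j < kap.ord) {X : ℕ → Bimod R S T}
    {h : ∀ j, X j →ₗ[BiRing R S T] A.V} (hh : ∀ j, Hds C.K (A.M (al j)) (A.M (be j)) (X j) (h j))
    {l k : ℕ} {v : A.V} (hv : v ∈ A.M (al k)) (w : ∀ j, X j) {m : ℕ} (hm : k ≤ m)
    (hmem : v - ∑ j ∈ Finset.range m, h j (w j) ∈ phi C.K e l A.V) :
    v - ∑ j ∈ Finset.range k, h j (w j) ∈ phi C.K e l A.V := by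
  induction m, hm using Nat.le_induction with
  | base => exact hmem
  | succ m hm ih =>
    refine ih ?_
    rw [Finset.sum_range_succ] at hmem
    have hgood : Good C.K (A.M (al m) ⊔ LinearMap.range (h m)) ⊤ :=
      ((hh m).almost.good).trans (A.good_top (hbe m).le (hbeSt m))
    refine left_mem_phi_of_add_mem (hh m).disjoint hgood (y := -h m (w m)) ?_ ?_ ?_
    · refine Submodule.sub_mem _ (A.M_le (hmono hm) (hal m).le hv)
        (Submodule.sum_mem _ fun j hj => ?_)
      exact A.M_le ((hle j).trans (hmono (Finset.mem_range.1 hj))) (hal m).le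
        ((hh j).range_le ⟨_, rfl⟩)
    · exact Submodule.neg_mem _ ⟨_, rfl⟩
    · convert hmem using 1
      abel

/-- If the control fails for all `α` and `n`, then witnesses of failure along a sequence converging
to a stage outside `St` contradict the approximation property. -/
theorem EndoApprox.exists_prMinus (hA : A.EndoApprox) {f : A.V →+ A.V}
    (hf : IsRLinear (R := R) (S := S) (T := T) f) (he : e ∈ C.E) :
    ∃ α < kap.ord, α ∉ St ∧ ∃ n, A.PrMinus f e α n := by
  classical
  by_contra hno
  have hbad : ∀ α n, ∃ (β : Ordinal.{u}) (h : e.N n →ₗ[BiRing R S T] A.V) (l : ℕ)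
      (θ : Ordinal.{u}), α < kap.ord → α ∉ St → α < β ∧ β < kap.ord ∧ β ∉ St ∧
      Hds C.K (A.M α) (A.M β) (e.N n) h ∧ θ < kap.ord ∧ f (h (e.x n)) ∈ A.M θ ∧
      ∀ a ∈ A.M α, ∀ b ∈ phi C.K e l A.V, ∀ c ∈ LinearMap.range h,
        f (h (e.x n)) ≠ a + b + c := by
    intro α n
    by_cases hα : α < kap.ord ∧ α ∉ St
    · have h1 : ¬ A.PrMinus f e α n := fun h => hno ⟨α, hα.1, hα.2, n, h⟩
      rw [PrMinus] at h1
      push Not at h1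
      obtain ⟨β, hαβ, hβ, hβSt, h, hh, l, hl⟩ := h1
      obtain ⟨θ, hθ, hfθ⟩ := A.exists_mem (f (h (e.x n)))
      exact ⟨β, h, l, θ, fun _ _ => ⟨hαβ, hβ, hβSt, hh, hθ, hfθ, hl⟩⟩
    · exact ⟨0, 0, 0, 0, fun h h' => absurd ⟨h, h'⟩ hα⟩
  choose be h l θ hbad using hbad
  have h0 := A.aleph0_lt_kap he
  -- a bound for everything that happens at the stage `α`
  let B : Ordinal.{u} → Ordinal.{u} := fun α =>
    if α < kap.ord ∧ α ∉ St then ⨆ n, max (be α n) (θ α n) else 0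
  have hB : ∀ α < kap.ord, B α < kap.ord := by
    intro α hα
    by_cases hSt : α ∉ St
    · simp only [B, if_pos (And.intro hα hSt)]
      refine nat_iSup_lt_ord A.kap_regular h0 fun n => ?_
      obtain ⟨-, h1, -, -, h2, -⟩ := hbad α n hα hSt
      exact max_lt h1 h2
    · simp only [B, hSt, and_false, if_false]
      exact A.isSuccLimit_kap.bot_lt
  have hBle : ∀ α < kap.ord, α ∉ St → ∀ n, be α n ≤ B α ∧ θ α n ≤ B α := by
    intro α hα hSt n
    simp only [B, if_pos (And.intro hα hSt)]
    exact max_le_iff.1 (Ordinal.le_iSup (fun n => max (be α n) (θ α n)) n)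
  obtain ⟨δ, hδ, hδSt, hδl, hδB, d, hd, hdcof⟩ := A.exists_closed h0 hB
  -- the stages and indices at which the failures are collected
  let p : ℕ → Ordinal.{u} × ℕ := fun k => Nat.rec (Order.succ 0, 0)
    (fun k q => (Order.succ (max (max q.1 (B q.1)) (d k)), max q.2 (l q.1 q.2) + 1)) k
  let al : ℕ → Ordinal.{u} := fun k => (p k).1
  let n : ℕ → ℕ := fun k => (p k).2
  have hal_succ : ∀ k, al (k + 1) = Order.succ (max (max (al k) (B (al k))) (d k)) := fun k => rfl
  have hn_succ : ∀ k, n (k + 1) = max (n k) (l (al k) (n k)) + 1 := fun k => rfl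
  have hal0 : al 0 = Order.succ 0 := rfl
  clear_value al n
  have halδ : ∀ k, al k < δ := by
    intro k
    induction k with
    | zero => rw [hal0]; exact hδl.succ_lt hδl.bot_lt
    | succ k ih => rw [hal_succ]; exact hδl.succ_lt (max_lt (max_lt ih (hδB _ ih)) (hd k))
  have halκ : ∀ k, al k < kap.ord := fun k => (halδ k).trans hδ
  have halSt : ∀ k, al k ∉ St := by
    intro k
    cases k with
    | zero => rw [hal0]; exact A.succ_notMem _
    | succ k => rw [hal_succ]; exact A.succ_notMem _
  have hmono : Monotone al := monotone_nat_of_le_succ fun k => by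
    rw [hal_succ]
    exact ((le_max_left _ _).trans (le_max_left _ _)).trans (Order.le_succ _)
  have hBal : ∀ k, B (al k) ≤ al (k + 1) := fun k => by
    rw [hal_succ]
    exact ((le_max_right _ _).trans (le_max_left _ _)).trans (Order.le_succ _)
  have hdal : ∀ k, d k ≤ al (k + 1) := fun k => by
    rw [hal_succ]
    exact (le_max_right _ _).trans (Order.le_succ _)
  have hn : StrictMono n := strictMono_nat_of_lt_succ fun k => by
    rw [hn_succ]
    exact Nat.lt_succ_of_le (le_max_left _ _)
  have hln : ∀ k, l (al k) (n k) ≤ n (k + 1) := fun k => by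
    rw [hn_succ]
    exact (le_max_right _ _).trans (Nat.le_succ _)
  have hstep := fun k => hbad (al k) (n k) (halκ k) (halSt k)
  have hbe : ∀ k, be (al k) (n k) ≤ al (k + 1) := fun k =>
    (hBle _ (halκ k) (halSt k) (n k)).1.trans (hBal k)
  let H : ∀ k, e.N (n k) →ₗ[BiRing R S T] A.V := fun k => h (al k) (n k)
  have hH : ∀ k, LinearMap.range (H k) ≤ A.M (al (k + 1)) := fun k =>
    (hstep k).2.2.2.1.range_le.trans (A.M_le (hbe k) (halκ _).le)
  have hfH : ∀ k, f (H k (e.x (n k))) ∈ A.M (al (k + 1)) := fun k =>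
    A.M_le ((hBle _ (halκ k) (halSt k) (n k)).2.trans (hBal k)) (halκ _).le
      (hstep k).2.2.2.2.2.1
  obtain ⟨y, z, zz, n₀, hprop⟩ := hA f hf (e.restrict n hn) (C.restrict_mem e he n hn) δ hδ H
    (fun k => (hH k).trans (A.M_le (halδ _).le hδ.le))
  -- `y` is projected to `M δ`, hence to some `M (al k)`
  obtain ⟨Q, -, hQd, hyQ, hQg⟩ := (A.good_top hδ.le hδSt).exists_extension (v := y) trivial
  obtain ⟨y', hy', q, hq, rfl⟩ := Submodule.mem_sup.1 hyQ
  obtain ⟨b, hb, hyb⟩ := A.exists_mem_M hδ.le hδl hy'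
  obtain ⟨k₁, hk₁⟩ := hdcof b hb
  obtain ⟨k, hkn, hk1⟩ : ∃ k, n₀ ≤ k ∧ k₁ + 1 ≤ k := ⟨max n₀ (k₁ + 1), by simp, by simp⟩
  have hyk : y' ∈ A.M (al k) :=
    A.M_le ((hk₁.trans (hdal k₁)).trans (hmono hk1)) (halκ k).le hyb
  have h1 : (∑ j ∈ Finset.range (k + 1), f (H j (e.x (n j)))) - (y' + q) -
      DirectSum.toModule (BiRing R S T) ℕ A.V H (zz (k + 1) 1) ∈ phi C.K e (n (k + 1)) A.V :=
    (hprop (k + 1) (by omega)).2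
  obtain ⟨m₀, hm₀⟩ := (e.restrict n hn).toModule_eq_sum H (zz (k + 1) 1)
  let w : ∀ j, e.N (n j) := fun j => (zz (k + 1) 1) j
  have hw : DirectSum.toModule (BiRing R S T) ℕ A.V H (zz (k + 1) 1) =
      ∑ j ∈ Finset.range (max m₀ (k + 1)), H j (w j) := hm₀ _ (le_max_left _ _)
  rw [hw] at h1
  set v : A.V := (∑ j ∈ Finset.range (k + 1), f (H j (e.x (n j)))) - y' with hv
  have hsumk : ∑ j ∈ Finset.range k, f (H j (e.x (n j))) ∈ A.M (al k) :=
    Submodule.sum_mem _ fun j hj =>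
      A.M_le (hmono (Finset.mem_range.1 hj)) (halκ k).le (hfH j)
  have hvk : v ∈ A.M (al (k + 1)) := by
    rw [hv, Finset.sum_range_succ]
    exact Submodule.sub_mem _ (Submodule.add_mem _
      (A.M_le (hmono (Nat.le_succ k)) (halκ _).le hsumk) (hfH k))
      (A.M_le (hmono (Nat.le_succ k)) (halκ _).le hyk)
  have h2 : v - ∑ j ∈ Finset.range (max m₀ (k + 1)), H j (w j) ∈
      phi C.K e (n (k + 1)) A.V := by
    refine left_mem_phi_of_add_mem hQd hQg (y := -q) ?_ (Q.neg_mem hq) ?_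
    · refine Submodule.sub_mem _ (A.M_le (halδ _).le hδ.le hvk)
        (Submodule.sum_mem _ fun j _ => A.M_le (halδ (j + 1)).le hδ.le (hH j ⟨_, rfl⟩))
    · convert h1 using 1
      rw [hv]
      abel
  have h3 := mem_phi_of_sub_sum_mem (fun j => (hstep j).2.1) (fun j => (hstep j).2.2.1) hbe hmono
    halκ (X := fun j => e.N (n j)) (h := H) (fun j => (hstep j).2.2.2.1) hvk w
    (le_max_right m₀ (k + 1)) h2
  refine (hstep k).2.2.2.2.2.2
    (y' - ∑ j ∈ Finset.range k, f (H j (e.x (n j))) + ∑ j ∈ Finset.range k, H j (w j)) ?_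
    (v - ∑ j ∈ Finset.range (k + 1), H j (w j)) (phi_antitone (hln k) h3) (H k (w k)) ⟨_, rfl⟩ ?_
  · exact Submodule.add_mem _ (Submodule.sub_mem _ hyk hsumk) (Submodule.sum_mem _ fun j hj =>
      A.M_le (hmono (Finset.mem_range.1 hj)) (halκ k).le (hH j ⟨_, rfl⟩))
  · rw [hv, Finset.sum_range_succ, Finset.sum_range_succ]
    change f (H k (e.x (n k))) = _
    abel

theorem PrOne.pr {f : A.V →+ A.V} {α : Ordinal.{u}} {n : ℕ} {z : e.N n}
    (h : A.PrOne f e α n z) : A.Pr f e α n := by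
  intro g l
  obtain ⟨a, ha, b, hb, hab⟩ := h g
  exact ⟨a, ha, b, Set.mem_iInter.1 hb l, g z, ⟨z, rfl⟩, sub_eq_iff_eq_add.1 hab⟩

end WeaklySemiNice

end

end SemiNice

theorem lemma2 {R S T : Type u} [Ring R] [Ring S] [CommRing T] [Algebra T R] [Algebra T S]
    (C : SemiNice.Context R S T) (lam kap : Cardinal.{u}) (St : Set Ordinal.{u})
    (γ : Ordinal.{u} → Ordinal.{u}) (hγ : SemiNice.GammaCondition lam kap γ)
    (A : SemiNice.WeaklySemiNice C lam kap St γ) (f : A.V →+ A.V)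
    (hf : SemiNice.IsRLinear (R := R) (S := S) (T := T) f)
    (e : SemiNice.ESystem R S T) (he : e ∈ C.E) :
    (∀ α < kap.ord, α ∉ St → ∀ n : ℕ, A.PrMinus f e α n →
      ∃ z ∈ SemiNice.L C.K e n, A.PrOne f e α n z) ∧
    (A.EndoApprox →
      (∃ α < kap.ord, α ∉ St ∧ ∃ n : ℕ, A.Pr f e α n) ∧
      (∃ α < kap.ord, ∃ n : ℕ, ∃ z ∈ SemiNice.L C.K e n, A.PrOne f e α n z)) := by
  have h1 : ∀ α < kap.ord, α ∉ St → ∀ n : ℕ, A.PrMinus f e α n →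
      ∃ z ∈ SemiNice.L C.K e n, A.PrOne f e α n z :=
    fun α hα hαSt n hP => hP.exists_prOne hf he hα hαSt
  refine ⟨h1, fun hA => ?_⟩
  obtain ⟨α, hα, hαSt, n, hP⟩ := hA.exists_prMinus hf he
  obtain ⟨z, hz, hz1⟩ := h1 α hα hαSt n hP
  exact ⟨⟨α, hα, hαSt, n, hz1.pr⟩, α, hα, n, z, hz, hz1⟩
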